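/- Let $n,k\ge 0$ and $M\ge 1$ be integers, $\mathcal M=\{1,\dots,M\}$, $\gamma>0$, and for $m\in\mathcal M$ let $A^m,D^m\in\mathbb R^{n\times n}$ and $\sigma^m\in\mathbb R^{n\times k}$. Let $|\cdot|$ be the Euclidean norm (and the corresponding operator norm). **Assumption 1.** There are $c_A,c_\sigma>0$ and $c_D$ such that, for all $m$ and $x$, $x'A^mx\le -c_A|x|^2$, $|\sigma^m|\le c_\sigma$, $D^m$ is symmetric positive definite, $x'D^mx\le c_D|x|^2$, and $c_A^2>c_Dc_\sigma^2/\gamma^2$. **Assumption 2.** There is $m_D>0$ such that $x'D^mx\ge m_D|x|^2$ for all $m$ and $x$, and $\frac{c_\sigma^2}{\gamma^2}m_D>\bigl(c_A-\sqrt{c_A^2-c_Dc_\sigma^2/\gamma^2}\bigr)^2$. **Semigroups.** For $T\ge 0$ and a function $V$ on $\mathbb R^n$ let $$S_T[V](x)=\sup_{w,\mu}\Bigl\{\int_0^T\bigl(\tfrac12\xi_t'D^{\mu_t}\xi_t-\tfrac{\gamma^2}{2}|w_t|^2\bigr)dt+V(\xi_T)\Bigr\},\qquad \dot\xi_t=A^{\mu_t}\xi_t+\sigma^{\mu_t}w_t,\quad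 \xi_0=x,$$ where the supremum (in the extended reals) is over all $w\in L^2_{loc}([0,\infty);\mathbb R^k)$ and all measurable $\mu$ with values in $\mathcal M$. Let $S^m_T$ be defined in the same way with $\mu\equiv m$ fixed, and let $\tilde S_\tau=\sup_{m\in\mathcal M}S^m_\tau$. **Riccati flow.** Let $\Sigma^m=\gamma^{-2}\sigma^m(\sigma^m)'$ and $\Phi_m(P)=(A^m)'P+PA^m+P\Sigma^mP+D^m$, and let $M^m_t[P_0]$ be the value at time $t$ of the maximal solution of $\dot P=\Phi_m(P)$, $P(0)=P_0$. Let $[\epsilon I,\lambda I]$ be the set of symmetric $P$ with $\epsilon I\le P\le\lambda I$ in the Loewner order. Put $$\lambda_1=\frac{\gamma^2\bigl(c_A-\sqrt{c_A^2-c_Dc_\sigma^2/\gamma^2}\bigr)}{c_\sigma^2},\qquad \lambda_2=\sqrt{m_D\gamma^2/c_\sigma^2}.$$ **Pruning.** A pruning operation $\mathcal P$ selects from a finite set $\{f_i\}_{i\in I}$ of functions, representing $f=\sup_{i\in I}f_i$, a subset $\{f_j\}_{j\in J}$, and one writes $\mathcal P[f]=\sup_{j\in J}f_j$. In $\{\mathcal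 P_\tau\circ\tilde S_\tau\}^N[V^0]$ the starting function $V^0$ is represented by the set $\{V^0\}$, and if $f$ is represented by $\{f_i\}_{i\in I}$, then $\tilde S_\tau[f]$ is represented by $\{S^m_\tau[f_i]: m\in\mathcal M,\ i\in I\}$. The family $(\mathcal P_\tau)_{\tau>0}$ *generates an error $O(\tau^r)$* if there is $L>0$ such that, for all $\tau>0$ and all suprema $f$ of finite nonempty sets of positive definite quadratic functions $x\mapsto\frac12x'Px$, $\ \mathcal P_\tau[f]\le f\le(1+L\tau^r)\,\mathcal P_\tau[f]$. **Theorem.** Suppose that Assumptions 1 and 2 hold. Let $\lambda\in[\lambda_1,\lambda_2)$, and let $\epsilon>0$ be such that $M^m_t[P_0]$ is defined and belongs to $[\epsilon I,\lambda I]$ for all $m\in\mathcal M$, $t\ge 0$ and $P_0\in[\epsilon I,\lambda I]$. 1. Let $r>1$ and let $(\mathcal P_\tau)_{\tau>0}$ generate an error $O(\tau^r)$. Then there are $\tau_0>0$ and $L>0$ such that $$S_{N\tau}[V^0](x)-\{\mathcal P_\tau\circ\tilde S_\tau\}^N[V^0](x)\le L\,\tau^{\min\{1,r-1\}}|x|^2$$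 for all $x\in\mathbb R^n$, all $N\in\mathbb N$, all $\tau\in(0,\tau_0]$ and all $V^0(x)=\frac12x'P_0x$ with $P_0\in[\epsilon I,\lambda I]$, both terms on the left being finite. 2. (No pruning, $r=\infty$.) There are $\tau_0>0$ and $L>0$ such that $$S_{N\tau}[V^0](x)-\{\tilde S_\tau\}^N[V^0](x)\le L\,\tau\,|x|^2$$ for the same $x$, $N$, $\tau$ and $V^0$, both terms on the left being finite. -/

import Mathlib

open MeasureTheory Set
open scoped Matrix Matrix.Norms.L2Operator MatrixOrder

/-- The data of a switching linear-quadratic control problem: `M` modes, state space `ℝⁿ`,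
disturbances in `ℝᵏ`. -/
structure SwitchedLQ (n k M : ℕ) where
  /-- drift matrices -/
  A : Fin M → Matrix (Fin n) (Fin n) ℝ
  /-- input matrices -/
  σ : Fin M → Matrix (Fin n) (Fin k) ℝ
  /-- running cost matrices -/
  D : Fin M → Matrix (Fin n) (Fin n) ℝ
  /-- attenuation parameter -/
  γ : ℝ

/-- The quadratic form `x' P x`. -/
def qform {n : ℕ} (P : Matrix (Fin n) (Fin n) ℝ) (x : EuclideanSpace ℝ (Fin n)) : ℝ :=
  x.ofLp ⬝ᵥ (P *ᵥ x.ofLp)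

/-- The quadratic function `x ↦ (1/2) x' P x`, with values in the extended reals. -/
noncomputable def quadFun {n : ℕ} (P : Matrix (Fin n) (Fin n) ℝ) :
    EuclideanSpace ℝ (Fin n) → EReal :=
  fun x => ((1 / 2 * qform P x : ℝ) : EReal)

namespace SwitchedLQ

variable {n k M : ℕ}

/-- First standing assumption, with constants `cA`, `cσ`, `cD`. The norm of `σ m` is the
operator norm for the Euclidean norms. -/
structure Assumption1 (p : SwitchedLQ n k M) (cA cσ cD : ℝ) : Prop where
  γ_pos : 0 < p.γ
  cA_pos : 0 < cA
  A_le : ∀ m x, qform (p.A m) x ≤ -cA * ‖x‖ ^ 2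
  cσ_pos : 0 < cσ
  σ_le : ∀ m, ‖p.σ m‖ ≤ cσ
  D_posDef : ∀ m, (p.D m).PosDef
  D_le : ∀ m x, qform (p.D m) x ≤ cD * ‖x‖ ^ 2
  gap : cD * cσ ^ 2 / p.γ ^ 2 < cA ^ 2

/-- Second standing assumption, with constant `mD`. -/
structure Assumption2 (p : SwitchedLQ n k M) (cA cσ cD mD : ℝ) : Prop where
  mD_pos : 0 < mD
  D_ge : ∀ m x, mD * ‖x‖ ^ 2 ≤ qform (p.D m) x
  gap : (cA - √(cA ^ 2 - cD * cσ ^ 2 / p.γ ^ 2)) ^ 2 < cσ ^ 2 / p.γ ^ 2 * mD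

/-- The threshold `λ₁`. -/
noncomputable def lam1 (p : SwitchedLQ n k M) (cA cσ cD : ℝ) : ℝ :=
  p.γ ^ 2 * (cA - √(cA ^ 2 - cD * cσ ^ 2 / p.γ ^ 2)) / cσ ^ 2

/-- The threshold `λ₂`. -/
noncomputable def lam2 (p : SwitchedLQ n k M) (cσ mD : ℝ) : ℝ :=
  √(mD * p.γ ^ 2 / cσ ^ 2)

/-- Admissible disturbances: square integrable on every bounded interval `[0, T]`. -/
def IsDisturbance (w : ℝ → EuclideanSpace ℝ (Fin k)) : Prop :=
  ∀ T : ℝ, MemLp w 2 (volume.restrict (Icc 0 T))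

/-- `ξ` solves `ξ' = A^{μ_t} ξ + σ^{μ_t} w_t`, `ξ_0 = x` on `[0, T]`, in the (Carathéodory) sense
of the integral equation. -/
def IsTrajectory (p : SwitchedLQ n k M) (T : ℝ) (x : EuclideanSpace ℝ (Fin n))
    (w : ℝ → EuclideanSpace ℝ (Fin k)) (μ : ℝ → Fin M)
    (ξ : ℝ → EuclideanSpace ℝ (Fin n)) : Prop :=
  ContinuousOn ξ (Icc 0 T) ∧
    ∀ t ∈ Icc 0 T, ξ t = x + ∫ s in (0 : ℝ)..t,
      WithLp.toLp 2 (p.A (μ s) *ᵥ (ξ s).ofLp + p.σ (μ s) *ᵥ (w s).ofLp)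

/-- The payoff `J(x, T; V; w, μ)`, where `ξ` is the trajectory from `x` driven by `(w, μ)`. -/
noncomputable def payoff (p : SwitchedLQ n k M) (T : ℝ) (V : EuclideanSpace ℝ (Fin n) → EReal)
    (w : ℝ → EuclideanSpace ℝ (Fin k)) (μ : ℝ → Fin M)
    (ξ : ℝ → EuclideanSpace ℝ (Fin n)) : EReal :=
  ((∫ t in (0 : ℝ)..T, (1 / 2 * qform (p.D (μ t)) (ξ t) - p.γ ^ 2 / 2 * ‖w t‖ ^ 2) : ℝ) : EReal)
    + V (ξ T)

/-- The semigroup `S_T`: supremum over disturbances and measurable switching controls. -/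
noncomputable def S (p : SwitchedLQ n k M) (T : ℝ) (V : EuclideanSpace ℝ (Fin n) → EReal) :
    EuclideanSpace ℝ (Fin n) → EReal :=
  fun x => sSup {v | ∃ w μ ξ, IsDisturbance w ∧ Measurable μ ∧ p.IsTrajectory T x w μ ξ ∧
    v = p.payoff T V w μ ξ}

/-- The semigroup `S^m_T` of mode `m`: the switching control is constantly `m`. -/
noncomputable def Sm (p : SwitchedLQ n k M) (m : Fin M) (T : ℝ)
    (V : EuclideanSpace ℝ (Fin n) → EReal) : EuclideanSpace ℝ (Fin n) → EReal :=
  fun x => sSup {v | ∃ w ξ, IsDisturbance w ∧ p.IsTrajectory T x w (fun _ => m) ξ ∧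
    v = p.payoff T V w (fun _ => m) ξ}

/-- The one-step operator without switching, `S̃_τ = sup_m S^m_τ`. -/
noncomputable def tildeS (p : SwitchedLQ n k M) (τ : ℝ) (V : EuclideanSpace ℝ (Fin n) → EReal) :
    EuclideanSpace ℝ (Fin n) → EReal :=
  fun x => ⨆ m, p.Sm m τ V x

/-- `Σ^m = σ^m (σ^m)' / γ²`. -/
noncomputable def Sig (p : SwitchedLQ n k M) (m : Fin M) : Matrix (Fin n) (Fin n) ℝ :=
  (1 / p.γ ^ 2) • (p.σ m * (p.σ m)ᵀ)

/-- The Riccati vector field `Φ_m(P) = A'P + PA + PΣP + D`. -/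
noncomputable def Phi (p : SwitchedLQ n k M) (m : Fin M) (P : Matrix (Fin n) (Fin n) ℝ) :
    Matrix (Fin n) (Fin n) ℝ :=
  (p.A m)ᵀ * P + P * p.A m + P * p.Sig m * P + p.D m

/-- The graph of the (partially defined) Riccati flow: `M^m_t[P₀]` is defined and equals `Q`. -/
def RiccatiFlow (p : SwitchedLQ n k M) (m : Fin M) (t : ℝ) (P₀ Q : Matrix (Fin n) (Fin n) ℝ) :
    Prop :=
  ∃ P : ℝ → Matrix (Fin n) (Fin n) ℝ, P 0 = P₀ ∧
    (∀ s ∈ Icc 0 t, HasDerivWithinAt P (p.Phi m (P s)) (Icc 0 t) s) ∧ P t = Q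

/-- The order interval `[εI, λI]` is invariant under the Riccati flow of every mode. -/
def IsInvariantInterval (p : SwitchedLQ n k M) (ε lam : ℝ) : Prop :=
  ∀ m, ∀ t : ℝ, 0 ≤ t →
    ∀ P₀ ∈ Icc (ε • (1 : Matrix (Fin n) (Fin n) ℝ)) (lam • (1 : Matrix (Fin n) (Fin n) ℝ)),
      ∃ Q ∈ Icc (ε • (1 : Matrix (Fin n) (Fin n) ℝ)) (lam • (1 : Matrix (Fin n) (Fin n) ℝ)),
        p.RiccatiFlow m t P₀ Q

open Classical in
/-- The operator `S̃_τ` on a finite set `F` of functions representing `sup F`: the set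
`{S^m_τ[f] : m, f ∈ F}`, whose supremum is `S̃_τ[sup F]` by `sup_stepSet`. -/
noncomputable def stepSet (p : SwitchedLQ n k M) (τ : ℝ)
    (F : Finset (EuclideanSpace ℝ (Fin n) → EReal)) :
    Finset (EuclideanSpace ℝ (Fin n) → EReal) :=
  (Finset.univ ×ˢ F).image fun q : Fin M × (EuclideanSpace ℝ (Fin n) → EReal) => p.Sm q.1 τ q.2

/-- The finite set of functions obtained from `{V}` after `N` steps of `S̃_τ`, each followed by
the pruning `prune`. -/
noncomputable def prunedSet (p : SwitchedLQ n k M) (τ : ℝ)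
    (prune : Finset (EuclideanSpace ℝ (Fin n) → EReal) →
      Finset (EuclideanSpace ℝ (Fin n) → EReal))
    (V : EuclideanSpace ℝ (Fin n) → EReal) :
    ℕ → Finset (EuclideanSpace ℝ (Fin n) → EReal)
  | 0 => {V}
  | N + 1 => prune (p.stepSet τ (p.prunedSet τ prune V N))

/-- The function `{𝒫_τ ∘ S̃_τ}^N[V]`. -/
noncomputable def prunedIterate (p : SwitchedLQ n k M) (τ : ℝ)
    (prune : Finset (EuclideanSpace ℝ (Fin n) → EReal) →
      Finset (EuclideanSpace ℝ (Fin n) → EReal))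
    (N : ℕ) (V : EuclideanSpace ℝ (Fin n) → EReal) : EuclideanSpace ℝ (Fin n) → EReal :=
  (p.prunedSet τ prune V N).sup id

theorem payoff_sup (p : SwitchedLQ n k M) (T : ℝ) (V W : EuclideanSpace ℝ (Fin n) → EReal)
    (w : ℝ → EuclideanSpace ℝ (Fin k)) (μ : ℝ → Fin M) (ξ : ℝ → EuclideanSpace ℝ (Fin n)) :
    p.payoff T (V ⊔ W) w μ ξ = p.payoff T V w μ ξ ⊔ p.payoff T W w μ ξ := by
  have h : Monotone fun y : EReal => ((∫ t in (0 : ℝ)..T,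
      (1 / 2 * qform (p.D (μ t)) (ξ t) - p.γ ^ 2 / 2 * ‖w t‖ ^ 2) : ℝ) : EReal) + y :=
    fun a b hab => add_le_add le_rfl hab
  exact h.map_sup _ _

theorem Sm_sup (p : SwitchedLQ n k M) (m : Fin M) (T : ℝ)
    (V W : EuclideanSpace ℝ (Fin n) → EReal) :
    p.Sm m T (V ⊔ W) = p.Sm m T V ⊔ p.Sm m T W := by
  funext x
  apply le_antisymm
  · refine sSup_le ?_
    rintro v ⟨w, ξ, hw, hξ, rfl⟩
    rw [payoff_sup]
    exact sup_le_sup (le_sSup ⟨w, ξ, hw, hξ, rfl⟩) (le_sSup ⟨w, ξ, hw, hξ, rfl⟩)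
  · refine sup_le (sSup_le ?_) (sSup_le ?_)
    · rintro v ⟨w, ξ, hw, hξ, rfl⟩
      refine le_sSup_of_le ⟨w, ξ, hw, hξ, rfl⟩ ?_
      rw [payoff_sup]; exact le_sup_left
    · rintro v ⟨w, ξ, hw, hξ, rfl⟩
      refine le_sSup_of_le ⟨w, ξ, hw, hξ, rfl⟩ ?_
      rw [payoff_sup]; exact le_sup_right

theorem Sm_bot (p : SwitchedLQ n k M) (m : Fin M) (T : ℝ) : p.Sm m T ⊥ = ⊥ := by
  funext x
  refine le_bot_iff.1 (sSup_le ?_)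
  rintro v ⟨w, ξ, hw, hξ, rfl⟩
  simp [payoff]

/-- Max-plus linearity: `stepSet` represents `S̃_τ` applied to the represented function. -/
theorem sup_stepSet (p : SwitchedLQ n k M) (τ : ℝ)
    (F : Finset (EuclideanSpace ℝ (Fin n) → EReal)) :
    (p.stepSet τ F).sup id = p.tildeS τ (F.sup id) := by
  classical
  have h : ∀ m, p.Sm m τ (F.sup id) = F.sup fun f => p.Sm m τ f := fun m =>
    Finset.apply_sup_eq_sup_comp (p.Sm m τ) (fun V W => p.Sm_sup m τ V W) (p.Sm_bot m τ)
  funext x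
  unfold stepSet tildeS
  simp only [h, Finset.sup_image, Finset.sup_product_left, Finset.sup_apply, Function.comp, id,
    Finset.sup_univ_eq_iSup]

end SwitchedLQ

/-- The family `prune τ`, `τ > 0`, of pruning operations generates an error `O(τ^r)`: it selects from
every nonempty finite set `F` of positive definite quadratic functions a subset `prune τ F` such that,
with a constant `L` independent of `τ` and `F`, and with `f = sup F`, `𝒫_τ[f] = sup (prune τ F)`,
one has `𝒫_τ[f] ≤ f ≤ (1 + L τ^r) 𝒫_τ[f]`. -/
def IsPruningOfOrder {n : ℕ}
    (prune : ℝ → Finset (EuclideanSpace ℝ (Fin n) → EReal) →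
      Finset (EuclideanSpace ℝ (Fin n) → EReal)) (r : ℝ) : Prop :=
  ∃ L : ℝ, 0 < L ∧ ∀ τ : ℝ, 0 < τ →
    ∀ F : Finset (EuclideanSpace ℝ (Fin n) → EReal), F.Nonempty →
      (∀ f ∈ F, ∃ P : Matrix (Fin n) (Fin n) ℝ, P.PosDef ∧ f = quadFun P) →
      prune τ F ⊆ F ∧ ∀ x, (prune τ F).sup id x ≤ F.sup id x ∧
        F.sup id x ≤ ((1 + L * τ ^ r : ℝ) : EReal) * (prune τ F).sup id x

/-! The estimate is uniform in `N` because the error is measured relatively: if the payoffs are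
bounded by `(1 + θ)` times the computed function, one more step replaces `θ` by `θ (1 - α τ) + C
τ²`, and pruning multiplies the resulting factor by `1 + L τ ^ r`. The error `θ = K τ ^ min 1 (r -
1)` survives this for large `K`, so it never grows with the number of steps.

The contraction comes from strict subhomogeneity of the Riccati field, `Φ((1+θ)P) - (1+θ)Φ(P) =
θ((1+θ)PΣP - D)`: below `λ₂` the term `PΣP` is dominated by `D`, with room to spare
(`qform_Phi_smul_le`).

The term `C τ²` is the price of not switching within a step. Completion of squares with a frozen `P`
writes any payoff as `(1/2) x'Px` plus the integral of `(1/2) ξ'Φ_μ(P)ξ` minus a penalty on the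
deviation of `w` from the feedback. Moving `ξ` back to `x` costs `O(τ²)|x|²`, the unbounded `w`
being absorbed by the penalty (`exists_payoff_le`). Conversely, the semigroup of a single mode is
the Riccati flow (`exists_Sm_eq`), which agrees with the same first-order expansion up to `O(τ²)`
(`exists_riccati_ge`). Choosing the mode that maximises the expansion at `x` gives
`exists_one_step`; `payoff_le_prunedSet` iterates it trajectory by trajectory, so that no dynamic
programming principle for `S` is needed. -/

open scoped RealInnerProductSpace

/-! ### Quadratic forms, operator norms and the Loewner order. -/

section MatrixVector

variable {m n k : ℕ}

/-- Matrix-vector multiplication on Euclidean spaces as a continuous bilinear map. -/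
noncomputable def mv : Matrix (Fin m) (Fin n) ℝ →L[ℝ]
    EuclideanSpace ℝ (Fin n) →L[ℝ] EuclideanSpace ℝ (Fin m) :=
  LinearMap.mkContinuous₂
    (Matrix.toEuclideanLin (𝕜 := ℝ) (m := Fin m) (n := Fin n)).toLinearMap 1 (by
      intro A x
      rw [one_mul]
      exact Matrix.l2_opNorm_mulVec A x)

theorem mv_apply (A : Matrix (Fin m) (Fin n) ℝ) (x : EuclideanSpace ℝ (Fin n)) :
    mv A x = WithLp.toLp 2 (A *ᵥ x.ofLp) := rfl

theorem norm_mv_le (A : Matrix (Fin m) (Fin n) ℝ) (x : EuclideanSpace ℝ (Fin n)) :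
    ‖mv A x‖ ≤ ‖A‖ * ‖x‖ := Matrix.l2_opNorm_mulVec A x

theorem norm_le_of_norm_mv_le {A : Matrix (Fin m) (Fin n) ℝ} {C : ℝ} (hC : 0 ≤ C)
    (h : ∀ x, ‖mv A x‖ ≤ C * ‖x‖) : ‖A‖ ≤ C := by
  rw [Matrix.l2_opNorm_def]
  exact ContinuousLinearMap.opNorm_le_bound _ hC h

theorem mv_mul (A : Matrix (Fin m) (Fin n) ℝ) (B : Matrix (Fin n) (Fin k) ℝ)
    (x : EuclideanSpace ℝ (Fin k)) : mv (A * B) x = mv A (mv B x) := by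
  simp [mv_apply, Matrix.mulVec_mulVec]

theorem mv_one (x : EuclideanSpace ℝ (Fin n)) : mv (1 : Matrix (Fin n) (Fin n) ℝ) x = x := by
  simp [mv_apply]

theorem inner_mv (A : Matrix (Fin m) (Fin n) ℝ) (x : EuclideanSpace ℝ (Fin n))
    (y : EuclideanSpace ℝ (Fin m)) : ⟪mv A x, y⟫ = ⟪x, mv Aᵀ y⟫ := by
  simp only [mv_apply, EuclideanSpace.inner_eq_star_dotProduct, star_trivial]
  rw [Matrix.dotProduct_mulVec, Matrix.mulVec_transpose, dotProduct_comm]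

theorem qform_eq_inner (P : Matrix (Fin n) (Fin n) ℝ) (x : EuclideanSpace ℝ (Fin n)) :
    qform P x = ⟪x, mv P x⟫ := by
  simp only [mv_apply, EuclideanSpace.inner_eq_star_dotProduct, star_trivial, qform]
  rw [dotProduct_comm]

theorem inner_mv_symm {P : Matrix (Fin n) (Fin n) ℝ} (hP : Pᵀ = P)
    (x y : EuclideanSpace ℝ (Fin n)) : ⟪mv P x, y⟫ = ⟪x, mv P y⟫ := by
  rw [inner_mv, hP]

theorem qform_add (P Q : Matrix (Fin n) (Fin n) ℝ) (x : EuclideanSpace ℝ (Fin n)) :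
    qform (P + Q) x = qform P x + qform Q x := by
  simp [qform_eq_inner, inner_add_right]

theorem qform_sub (P Q : Matrix (Fin n) (Fin n) ℝ) (x : EuclideanSpace ℝ (Fin n)) :
    qform (P - Q) x = qform P x - qform Q x := by
  simp [qform_eq_inner, inner_sub_right]

theorem qform_smul (c : ℝ) (P : Matrix (Fin n) (Fin n) ℝ) (x : EuclideanSpace ℝ (Fin n)) :
    qform (c • P) x = c * qform P x := by
  simp [qform_eq_inner, inner_smul_right]

theorem qform_one (x : EuclideanSpace ℝ (Fin n)) :
    qform (1 : Matrix (Fin n) (Fin n) ℝ) x = ‖x‖ ^ 2 := by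
  rw [qform_eq_inner, mv_one, real_inner_self_eq_norm_sq]

theorem abs_qform_le (P : Matrix (Fin n) (Fin n) ℝ) (x : EuclideanSpace ℝ (Fin n)) :
    |qform P x| ≤ ‖P‖ * ‖x‖ ^ 2 := by
  rw [qform_eq_inner]
  calc _ ≤ ‖x‖ * ‖mv P x‖ := abs_real_inner_le_norm _ _
    _ ≤ ‖x‖ * (‖P‖ * ‖x‖) := by gcongr; exact norm_mv_le _ _
    _ = _ := by ring

theorem le_iff_qform_le {P Q : Matrix (Fin n) (Fin n) ℝ} :
    P ≤ Q ↔ (Q - P)ᵀ = Q - P ∧ ∀ x, qform P x ≤ qform Q x := by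
  rw [Matrix.le_iff, Matrix.posSemidef_iff_dotProduct_mulVec]
  refine and_congr ?_ ?_
  · rw [Matrix.IsHermitian, Matrix.conjTranspose_eq_transpose_of_trivial]
  · constructor
    · intro h x
      have h1 : 0 ≤ qform (Q - P) x := h x.ofLp
      rw [qform_sub] at h1
      linarith
    · intro h x
      have h1 := h (WithLp.toLp 2 x)
      have h2 : 0 ≤ qform (Q - P) (WithLp.toLp 2 x) := by
        rw [qform_sub]; linarith
      exact h2

/-- The order interval `[εI, λI]` in terms of quadratic forms. -/
theorem mem_Icc_smul_one_iff {P : Matrix (Fin n) (Fin n) ℝ} {ε lam : ℝ} :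
    P ∈ Icc (ε • (1 : Matrix (Fin n) (Fin n) ℝ)) (lam • (1 : Matrix (Fin n) (Fin n) ℝ)) ↔
      Pᵀ = P ∧ ∀ x, ε * ‖x‖ ^ 2 ≤ qform P x ∧ qform P x ≤ lam * ‖x‖ ^ 2 := by
  rw [mem_Icc, le_iff_qform_le, le_iff_qform_le]
  simp only [qform_smul, qform_one, Matrix.transpose_sub, Matrix.transpose_smul,
    Matrix.transpose_one, sub_left_inj, sub_right_inj, forall_and]
  tauto

/-- Polarisation with `y = Px / c`: by the parallelogram law `4c|y|² = 4⟪Px, y⟫ ≤ 2c(|x|² + |y|²)`,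
hence `|y| ≤ |x|`. No spectral theorem is involved. -/
theorem norm_mv_le_of_abs_qform_le {P : Matrix (Fin n) (Fin n) ℝ} (hP : Pᵀ = P) {c : ℝ}
    (hc : 0 < c) (h : ∀ x, |qform P x| ≤ c * ‖x‖ ^ 2) (x : EuclideanSpace ℝ (Fin n)) :
    ‖mv P x‖ ≤ c * ‖x‖ := by
  set y := (1 / c) • mv P x with hy
  have hpol : 4 * ⟪mv P x, y⟫ = qform P (x + y) - qform P (x - y) := by
    simp only [qform_eq_inner, map_add, map_sub, inner_add_left, inner_add_right, inner_sub_left,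
      inner_sub_right]
    have h1 : ⟪x, mv P y⟫ = ⟪mv P x, y⟫ := (inner_mv_symm hP x y).symm
    have h2 : ⟪y, mv P x⟫ = ⟪mv P x, y⟫ := real_inner_comm _ _
    rw [h1, h2]; ring
  have h1 := (abs_le.1 (h (x + y))).2
  have h2 := (abs_le.1 (h (x - y))).1
  have hpar := parallelogram_law_with_norm ℝ x y
  have hyn : c * ‖y‖ = ‖mv P x‖ := by
    rw [hy, norm_smul, Real.norm_of_nonneg (by positivity)]; field_simp
  have hin : ⟪mv P x, y⟫ = c * ‖y‖ ^ 2 := by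
    have : mv P x = c • y := by rw [hy, smul_smul]; field_simp; simp
    rw [this, inner_smul_left, real_inner_self_eq_norm_sq]; simp
  have hle : ‖y‖ ^ 2 ≤ ‖x‖ ^ 2 := by
    have : c * (2 * ‖y‖ ^ 2) ≤ c * (2 * ‖x‖ ^ 2) := by nlinarith
    have := le_of_mul_le_mul_left this hc
    linarith
  rw [← hyn]
  exact mul_le_mul_of_nonneg_left (abs_le_of_sq_le_sq' hle (norm_nonneg _)).2 hc.le

theorem norm_le_of_mem_Icc {P : Matrix (Fin n) (Fin n) ℝ} {ε lam : ℝ} (hε : 0 ≤ ε)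
    (hl : 0 < lam)
    (h : P ∈ Icc (ε • (1 : Matrix (Fin n) (Fin n) ℝ)) (lam • (1 : Matrix (Fin n) (Fin n) ℝ))) :
    ‖P‖ ≤ lam := by
  obtain ⟨h1, h2⟩ := mem_Icc_smul_one_iff.1 h
  refine norm_le_of_norm_mv_le hl.le (norm_mv_le_of_abs_qform_le h1 hl fun x => ?_)
  rw [abs_of_nonneg ((by positivity : 0 ≤ ε * ‖x‖ ^ 2).trans (h2 x).1)]
  exact (h2 x).2

theorem posDef_of_mem_Icc {P : Matrix (Fin n) (Fin n) ℝ} {ε lam : ℝ} (hε : 0 < ε)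
    (h : P ∈ Icc (ε • (1 : Matrix (Fin n) (Fin n) ℝ)) (lam • (1 : Matrix (Fin n) (Fin n) ℝ))) :
    P.PosDef := by
  obtain ⟨h1, h2⟩ := mem_Icc_smul_one_iff.1 h
  rw [Matrix.posDef_iff_dotProduct_mulVec]
  refine ⟨by rwa [Matrix.IsHermitian, Matrix.conjTranspose_eq_transpose_of_trivial], ?_⟩
  intro x hx
  have := (h2 (WithLp.toLp 2 x)).1
  have hx' : 0 < ‖WithLp.toLp 2 x‖ := norm_pos_iff.2 (by simpa using hx)
  exact (by positivity : 0 < ε * ‖WithLp.toLp 2 x‖ ^ 2).trans_le this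

end MatrixVector

/-! ### Product rule for quadratic forms along absolutely continuous curves. -/

section ProductRule

open AbsolutelyContinuousOnInterval in
-- Applied with `H` a primitive of an integrable function that dominates the increments of `f`.
theorem AbsolutelyContinuousOnInterval.of_dist_le {X Y : Type*} [PseudoMetricSpace X]
    [PseudoMetricSpace Y] {f : ℝ → X} {H : ℝ → Y} {a b : ℝ}
    (hH : AbsolutelyContinuousOnInterval H a b)
    (h : ∀ s ∈ uIcc a b, ∀ t ∈ uIcc a b, dist (f s) (f t) ≤ dist (H s) (H t)) :
    AbsolutelyContinuousOnInterval f a b := by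
  rw [absolutelyContinuousOnInterval_iff] at hH ⊢
  intro ε hε
  obtain ⟨δ, hδ, h1⟩ := hH ε hε
  refine ⟨δ, hδ, fun E hE hlt => lt_of_le_of_lt (Finset.sum_le_sum fun i hi => ?_) (h1 E hE hlt)⟩
  have hE' := hE.1 i hi
  exact h _ hE'.1 _ hE'.2

variable {n : ℕ}

/-- Product rule for `t ↦ x_t' Q_t x_t` along an absolutely continuous curve. -/
theorem qform_eq_add_integral {T : ℝ} (hT : 0 ≤ T) {ξ g : ℝ → EuclideanSpace ℝ (Fin n)}
    {x : EuclideanSpace ℝ (Fin n)} (hg : IntervalIntegrable g volume 0 T)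
    (hξ : ∀ t ∈ Icc 0 T, ξ t = x + ∫ s in (0 : ℝ)..t, g s)
    {Q Q' : ℝ → Matrix (Fin n) (Fin n) ℝ}
    (hQ : ∀ t ∈ Icc 0 T, HasDerivWithinAt Q (Q' t) (Icc 0 T) t) (hQ' : ContinuousOn Q' (Icc 0 T))
    (hsymm : ∀ t ∈ Icc 0 T, (Q t)ᵀ = Q t) :
    qform (Q T) (ξ T) = qform (Q 0) x +
      ∫ t in (0 : ℝ)..T, (2 * ⟪mv (Q t) (ξ t), g t⟫ + qform (Q' t) (ξ t)) := by
  have hgn : ∀ s ∈ Icc 0 T, ∀ t ∈ Icc 0 T, IntervalIntegrable g volume s t := fun s hs t ht =>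
    hg.mono_set (by rw [uIcc_of_le hT]; exact uIcc_subset_Icc hs ht)
  have h0 : (0 : ℝ) ∈ Icc 0 T := ⟨le_rfl, hT⟩
  have hTT : T ∈ Icc 0 T := ⟨hT, le_rfl⟩
  have hdiff : ∀ s ∈ Icc 0 T, ∀ t ∈ Icc 0 T, ξ t - ξ s = ∫ r in s..t, g r := by
    intro s hs t ht
    rw [hξ t ht, hξ s hs, add_sub_add_left_eq_sub,
      intervalIntegral.integral_interval_sub_left (hgn _ h0 _ ht) (hgn _ h0 _ hs)]
  have hξc : ContinuousOn ξ (Icc 0 T) := by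
    have : ContinuousOn (fun t => x + ∫ s in (0 : ℝ)..t, g s) (Icc 0 T) := by
      refine continuousOn_const.add ?_
      have := intervalIntegral.continuousOn_primitive_interval' hg (a := 0) (by simp)
      rwa [uIcc_of_le hT] at this
    exact this.congr hξ
  have hQc : ContinuousOn Q (Icc 0 T) := fun t ht => (hQ t ht).continuousWithinAt
  obtain ⟨R, hR⟩ := isCompact_Icc.exists_bound_of_continuousOn hξc
  obtain ⟨B, hB⟩ := isCompact_Icc.exists_bound_of_continuousOn hQc
  obtain ⟨C, hC⟩ := isCompact_Icc.exists_bound_of_continuousOn hQ'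
  have hR0 : 0 ≤ R := (norm_nonneg _).trans (hR 0 h0)
  have hB0 : 0 ≤ B := (norm_nonneg _).trans (hB 0 h0)
  have hC0 : 0 ≤ C := (norm_nonneg _).trans (hC 0 h0)
  -- Two increments of `ξ`, each weighted by `B R`, and one of `Q`, weighted by `R ^ 2`, make up an
  -- increment of the quadratic form; `f` integrates the sum of their bounds.
  set f : ℝ → ℝ := fun r => 2 * B * R * ‖g r‖ + R ^ 2 * C with hf
  have hfi : IntervalIntegrable f volume 0 T :=
    (hg.norm.const_mul _).add intervalIntegrable_const
  have hf0 : ∀ r, 0 ≤ f r := fun r => by simp only [hf]; positivity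
  have key : ∀ s ∈ Icc 0 T, ∀ t ∈ Icc 0 T, s ≤ t →
      |qform (Q t) (ξ t) - qform (Q s) (ξ s)| ≤ ∫ r in s..t, f r := by
    intro s hs t ht hst
    have e : qform (Q t) (ξ t) - qform (Q s) (ξ s) =
        ⟪ξ t - ξ s, mv (Q t) (ξ t)⟫ + ⟪ξ s, mv (Q t) (ξ t - ξ s)⟫ + qform (Q t - Q s) (ξ s) := by
      simp only [qform_eq_inner, map_sub, inner_sub_left, inner_sub_right,
        sub_apply]
      ring
    have n1 : ‖ξ t - ξ s‖ ≤ ∫ r in s..t, ‖g r‖ := by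
      rw [hdiff s hs t ht]; exact intervalIntegral.norm_integral_le_integral_norm hst
    have n2 : ‖Q t - Q s‖ ≤ C * (t - s) := by
      have := (convex_Icc (0 : ℝ) T).norm_image_sub_le_of_norm_hasDerivWithin_le hQ hC hs ht
      rwa [Real.norm_of_nonneg (sub_nonneg.2 hst)] at this
    have m1 : |⟪ξ t - ξ s, mv (Q t) (ξ t)⟫| ≤ ‖ξ t - ξ s‖ * (B * R) := by
      refine (abs_real_inner_le_norm _ _).trans ?_
      gcongr
      refine (norm_mv_le _ _).trans ?_
      exact mul_le_mul (hB t ht) (hR t ht) (norm_nonneg _) hB0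
    have m2 : |⟪ξ s, mv (Q t) (ξ t - ξ s)⟫| ≤ R * (B * ‖ξ t - ξ s‖) := by
      refine (abs_real_inner_le_norm _ _).trans ?_
      refine mul_le_mul (hR s hs) ((norm_mv_le _ _).trans ?_) (norm_nonneg _) hR0
      gcongr; exact hB t ht
    have m3 : |qform (Q t - Q s) (ξ s)| ≤ C * (t - s) * R ^ 2 := by
      refine (abs_qform_le _ _).trans ?_
      have := hR s hs
      gcongr
    have hint : ∫ r in s..t, f r = 2 * B * R * (∫ r in s..t, ‖g r‖) + R ^ 2 * C * (t - s) := by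
      rw [intervalIntegral.integral_add ((hgn s hs t ht).norm.const_mul _)
        intervalIntegrable_const, intervalIntegral.integral_const_mul]
      simp; ring
    rw [e, hint]
    refine (abs_add_three _ _ _).trans ?_
    have : 2 * B * R * ‖ξ t - ξ s‖ ≤ 2 * B * R * (∫ r in s..t, ‖g r‖) := by gcongr
    linarith
  have hac : AbsolutelyContinuousOnInterval (fun t => qform (Q t) (ξ t)) 0 T := by
    refine (hfi.absolutelyContinuousOnInterval_intervalIntegral (c := 0) (by simp)).of_dist_le ?_
    have hfn : ∀ s ∈ Icc 0 T, ∀ t ∈ Icc 0 T, IntervalIntegrable f volume s t := fun s hs t ht =>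
      hfi.mono_set (by rw [uIcc_of_le hT]; exact uIcc_subset_Icc hs ht)
    have main : ∀ s ∈ Icc 0 T, ∀ t ∈ Icc 0 T, s ≤ t →
        dist (qform (Q t) (ξ t)) (qform (Q s) (ξ s)) ≤
          dist (∫ r in (0 : ℝ)..t, f r) (∫ r in (0 : ℝ)..s, f r) := by
      intro s hs t ht hst
      rw [Real.dist_eq, Real.dist_eq, intervalIntegral.integral_interval_sub_left
        (hfn _ h0 _ ht) (hfn _ h0 _ hs)]
      exact (key s hs t ht hst).trans (le_abs_self _)
    rw [uIcc_of_le hT]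
    intro s hs t ht
    rcases le_total s t with hst | hst
    · rw [dist_comm, dist_comm (∫ r in (0 : ℝ)..s, f r)]; exact main s hs t ht hst
    · exact main t ht s hs hst
  have hx : ξ 0 = x := by simpa using hξ 0 h0
  have hftc := hac.integral_deriv_eq_sub
  rw [hx] at hftc
  rw [← sub_eq_iff_eq_add', ← hftc]
  refine intervalIntegral.integral_congr_ae ?_
  -- The curve `Q` is only differentiable within `Icc 0 T`, so the right endpoint is discarded; the
  -- left one is not in `Ioc 0 T`.
  have hne : ∀ᵐ t : ℝ, t ≠ T := by simp [ae_iff]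
  filter_upwards [hg.ae_hasDerivAt_integral, hne] with t ht htT htm
  rw [uIoc_of_le hT] at htm
  have htI : t ∈ Icc 0 T := ⟨htm.1.le, htm.2⟩
  have hnhds : Icc 0 T ∈ nhds t := Icc_mem_nhds htm.1 (lt_of_le_of_ne htm.2 htT)
  have d1 : HasDerivAt ξ (g t) t := by
    have := (ht (by rwa [uIcc_of_le hT]) 0 (by simp)).const_add x
    exact this.congr_of_eventuallyEq (Filter.eventually_of_mem hnhds hξ)
  have d2 : HasDerivAt Q (Q' t) t := (hQ t htI).hasDerivAt hnhds
  have d3 : HasDerivAt (fun t => mv (Q t) (ξ t)) (mv (Q' t) (ξ t) + mv (Q t) (g t)) t := by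
    have hm : HasDerivAt (fun t => mv (Q t)) (mv (Q' t)) t :=
      (mv (m := n) (n := n)).hasFDerivAt.comp_hasDerivAt t d2
    exact hm.clm_apply d1
  have d4 := d1.inner ℝ d3
  have : deriv (fun t => qform (Q t) (ξ t)) t =
      ⟪ξ t, mv (Q' t) (ξ t) + mv (Q t) (g t)⟫ + ⟪g t, mv (Q t) (ξ t)⟫ := by
    simp only [qform_eq_inner]; exact d4.deriv
  rw [this, inner_add_right, ← inner_mv_symm (hsymm t htI), real_inner_comm (mv (Q t) (ξ t)) (g t),
    qform_eq_inner]
  ring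

end ProductRule

/-! ### Square-integrable functions on bounded intervals. -/

section SquareIntegrable

variable {E : Type*} [NormedAddCommGroup E] {T : ℝ}

theorem ContinuousOn.memLp_Icc {a b : ℝ} {u : ℝ → E} (hu : ContinuousOn u (Icc a b))
    (p : ENNReal) : MemLp u p (volume.restrict (Icc a b)) := by
  obtain ⟨R, hR⟩ := isCompact_Icc.exists_bound_of_continuousOn hu
  exact MemLp.of_bound (hu.aestronglyMeasurable_of_isCompact isCompact_Icc measurableSet_Icc) R
    (ae_restrict_of_forall_mem measurableSet_Icc hR)

theorem MeasureTheory.MemLp.integrable_real_inner [InnerProductSpace ℝ E] {α : Type*}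
    [MeasurableSpace α] {ν : Measure α} {u v : α → E} (hu : MemLp u 2 ν) (hv : MemLp v 2 ν) :
    Integrable (fun t => ⟪u t, v t⟫) ν := by
  refine ((hu.integrable_norm_pow (p := 2) two_ne_zero).add
    (hv.integrable_norm_pow (p := 2) two_ne_zero)).mono' (hu.1.inner hv.1) (.of_forall fun t => ?_)
  have := abs_real_inner_le_norm (u t) (v t)
  rw [Real.norm_eq_abs]
  simp only [Pi.add_apply]
  nlinarith [sq_nonneg (‖u t‖ - ‖v t‖), sq_nonneg (‖u t‖), sq_nonneg (‖v t‖)]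

theorem MeasureTheory.MemLp.intervalIntegrable_of_two (hT : 0 ≤ T) {u : ℝ → E}
    (hu : MemLp u 2 (volume.restrict (Icc 0 T))) : IntervalIntegrable u volume 0 T :=
  (intervalIntegrable_iff_integrableOn_Icc_of_le hT).2 (hu.integrable one_le_two)

theorem memLp_mv_comp {m n M : ℕ} (B : Fin M → Matrix (Fin m) (Fin n) ℝ) {μ : ℝ → Fin M}
    (hμ : Measurable μ) {ν : Measure ℝ} {u : ℝ → EuclideanSpace ℝ (Fin n)} (hu : MemLp u 2 ν) :
    MemLp (fun t => mv (B (μ t)) (u t)) 2 ν := by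
  obtain ⟨K, hK⟩ := Finite.exists_le (fun m => ‖B m‖)
  have h1 : StronglyMeasurable fun t => B (μ t) :=
    (StronglyMeasurable.of_discrete (f := B)).comp_measurable hμ
  refine hu.of_le_mul (c := K)
    ((mv (m := m) (n := n)).aestronglyMeasurable_comp₂ h1.aestronglyMeasurable hu.1)
    (.of_forall fun t => ?_)
  refine (norm_mv_le _ _).trans ?_
  gcongr; exact hK _

/-- Cauchy–Schwarz, read off from the nonnegative integral of `(‖u‖ - Y/T)²`, where `Y/T` is the
mean of `‖u‖`. -/
theorem sq_integral_norm_le (hT : 0 < T) {u : ℝ → E}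
    (hu : MemLp u 2 (volume.restrict (Icc 0 T))) :
    (∫ t in (0 : ℝ)..T, ‖u t‖) ^ 2 ≤ T * ∫ t in (0 : ℝ)..T, ‖u t‖ ^ 2 := by
  set Y := ∫ t in (0 : ℝ)..T, ‖u t‖ with hY
  have h1 : IntervalIntegrable (fun t => ‖u t‖) volume 0 T := hu.norm.intervalIntegrable_of_two hT.le
  have h2 : IntervalIntegrable (fun t => ‖u t‖ ^ 2) volume 0 T :=
    (intervalIntegrable_iff_integrableOn_Icc_of_le hT.le).2
      (hu.integrable_norm_pow (p := 2) two_ne_zero)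
  have h3 : 0 ≤ ∫ t in (0 : ℝ)..T, (‖u t‖ ^ 2 - 2 * (Y / T) * ‖u t‖ + (Y / T) ^ 2) := by
    refine intervalIntegral.integral_nonneg hT.le fun t _ => ?_
    nlinarith [sq_nonneg (‖u t‖ - Y / T)]
  rw [intervalIntegral.integral_add (h2.sub (h1.const_mul _)) intervalIntegrable_const,
    intervalIntegral.integral_sub h2 (h1.const_mul _), intervalIntegral.integral_const_mul, ← hY]
    at h3
  simp only [intervalIntegral.integral_const, sub_zero, smul_eq_mul] at h3
  have h4 : 0 ≤ T * ((∫ t in (0 : ℝ)..T, ‖u t‖ ^ 2) - 2 * (Y / T) * Y + T * (Y / T) ^ 2) :=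
    mul_nonneg hT.le h3
  have h5 : T * ((∫ t in (0 : ℝ)..T, ‖u t‖ ^ 2) - 2 * (Y / T) * Y + T * (Y / T) ^ 2) =
      T * (∫ t in (0 : ℝ)..T, ‖u t‖ ^ 2) - Y ^ 2 := by
    field_simp; ring
  linarith

end SquareIntegrable

/-! ### Completion of squares and the verification identity. -/

namespace SwitchedLQ

variable {n k M : ℕ}

/-- The running part of the payoff. -/
noncomputable def cost (p : SwitchedLQ n k M) (T : ℝ) (w : ℝ → EuclideanSpace ℝ (Fin k))
    (μ : ℝ → Fin M) (ξ : ℝ → EuclideanSpace ℝ (Fin n)) : ℝ :=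
  ∫ t in (0 : ℝ)..T, (1 / 2 * qform (p.D (μ t)) (ξ t) - p.γ ^ 2 / 2 * ‖w t‖ ^ 2)

/-- The deviation of the disturbance `w` from the feedback `γ⁻² σ' P ξ`. -/
noncomputable def deviation (p : SwitchedLQ n k M) (m : Fin M) (P : Matrix (Fin n) (Fin n) ℝ)
    (x : EuclideanSpace ℝ (Fin n)) (w : EuclideanSpace ℝ (Fin k)) : EuclideanSpace ℝ (Fin k) :=
  w - (1 / p.γ ^ 2) • mv (p.σ m)ᵀ (mv P x)

theorem cost_integrable (p : SwitchedLQ n k M) {T : ℝ} {w : ℝ → EuclideanSpace ℝ (Fin k)}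
    {μ : ℝ → Fin M} {ξ : ℝ → EuclideanSpace ℝ (Fin n)} (hw : IsDisturbance w) (hμ : Measurable μ)
    (hξ : ContinuousOn ξ (Icc 0 T)) :
    IntegrableOn (fun t => 1 / 2 * qform (p.D (μ t)) (ξ t) - p.γ ^ 2 / 2 * ‖w t‖ ^ 2)
      (Icc 0 T) := by
  have h1 := hξ.memLp_Icc 2
  refine Integrable.sub (Integrable.const_mul ?_ _)
    (((hw T).integrable_norm_pow (p := 2) two_ne_zero).const_mul _)
  simp only [qform_eq_inner]
  exact h1.integrable_real_inner (memLp_mv_comp p.D hμ h1)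

theorem velocity_memLp (p : SwitchedLQ n k M) {T : ℝ} {w : ℝ → EuclideanSpace ℝ (Fin k)}
    {μ : ℝ → Fin M} {ξ : ℝ → EuclideanSpace ℝ (Fin n)} (hw : IsDisturbance w) (hμ : Measurable μ)
    (hξ : ContinuousOn ξ (Icc 0 T)) :
    MemLp (fun t => mv (p.A (μ t)) (ξ t) + mv (p.σ (μ t)) (w t)) 2 (volume.restrict (Icc 0 T)) :=
  (memLp_mv_comp p.A hμ (hξ.memLp_Icc 2)).add (memLp_mv_comp p.σ hμ (hw T))

theorem deviation_memLp (p : SwitchedLQ n k M) {T : ℝ} {w : ℝ → EuclideanSpace ℝ (Fin k)}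
    {μ : ℝ → Fin M} {ξ : ℝ → EuclideanSpace ℝ (Fin n)} (hw : IsDisturbance w) (hμ : Measurable μ)
    (hξ : ContinuousOn ξ (Icc 0 T)) {Q : ℝ → Matrix (Fin n) (Fin n) ℝ}
    (hQ : ContinuousOn Q (Icc 0 T)) :
    MemLp (fun t => p.deviation (μ t) (Q t) (ξ t) (w t)) 2 (volume.restrict (Icc 0 T)) := by
  have h1 : ContinuousOn (fun t => mv (Q t) (ξ t)) (Icc 0 T) :=
    ((mv (m := n) (n := n)).continuous.comp_continuousOn hQ).clm_apply hξ
  have h2 := (memLp_mv_comp (fun m => (p.σ m)ᵀ) hμ (h1.memLp_Icc 2)).const_smul (1 / p.γ ^ 2)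
  exact (hw T).sub h2

/-- The term `PΣP` appears as a squared norm, the form needed both to complete the square and to
compare it with `D`. -/
theorem qform_Phi (p : SwitchedLQ n k M) (m : Fin M) {P : Matrix (Fin n) (Fin n) ℝ}
    (hP : Pᵀ = P) (x : EuclideanSpace ℝ (Fin n)) :
    qform (p.Phi m P) x = 2 * ⟪mv P x, mv (p.A m) x⟫ +
      1 / p.γ ^ 2 * ‖mv (p.σ m)ᵀ (mv P x)‖ ^ 2 + qform (p.D m) x := by
  have e1 : qform ((p.A m)ᵀ * P) x = ⟪mv P x, mv (p.A m) x⟫ := by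
    rw [qform_eq_inner, mv_mul, ← inner_mv, real_inner_comm]
  have e2 : qform (P * p.A m) x = ⟪mv P x, mv (p.A m) x⟫ := by
    rw [qform_eq_inner, mv_mul, inner_mv_symm hP]
  have e3 : qform (P * p.Sig m * P) x = 1 / p.γ ^ 2 * ‖mv (p.σ m)ᵀ (mv P x)‖ ^ 2 := by
    rw [qform_eq_inner, mv_mul, mv_mul, ← inner_mv_symm hP, Sig, map_smul, smul_apply,
      inner_smul_right, mv_mul, ← real_inner_self_eq_norm_sq, inner_mv (p.σ m)ᵀ, Matrix.transpose_transpose]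
  rw [Phi, qform_add, qform_add, qform_add, e1, e2, e3]
  ring

/-- Completion of squares for the Hamiltonian. -/
theorem hamiltonian_eq (p : SwitchedLQ n k M) (hγ : 0 < p.γ) (m : Fin M)
    {P : Matrix (Fin n) (Fin n) ℝ} (hP : Pᵀ = P) (x : EuclideanSpace ℝ (Fin n))
    (w : EuclideanSpace ℝ (Fin k)) :
    1 / 2 * qform (p.D m) x - p.γ ^ 2 / 2 * ‖w‖ ^ 2 +
        ⟪mv P x, mv (p.A m) x + mv (p.σ m) w⟫ =
      1 / 2 * qform (p.Phi m P) x - p.γ ^ 2 / 2 * ‖p.deviation m P x w‖ ^ 2 := by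
  rw [p.qform_Phi m hP, deviation, @norm_sub_sq_real, inner_smul_right, norm_smul, inner_add_right]
  have : ⟪mv P x, mv (p.σ m) w⟫ = ⟪w, mv (p.σ m)ᵀ (mv P x)⟫ := by
    rw [← inner_mv, real_inner_comm]
  rw [this, Real.norm_of_nonneg (by positivity)]
  field_simp
  ring

theorem IsTrajectory.eq_add_integral {p : SwitchedLQ n k M} {T : ℝ}
    {x : EuclideanSpace ℝ (Fin n)} {w : ℝ → EuclideanSpace ℝ (Fin k)} {μ : ℝ → Fin M}
    {ξ : ℝ → EuclideanSpace ℝ (Fin n)} (h : p.IsTrajectory T x w μ ξ) :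
    ∀ t ∈ Icc 0 T, ξ t = x + ∫ s in (0 : ℝ)..t, (mv (p.A (μ s)) (ξ s) + mv (p.σ (μ s)) (w s)) :=
  h.2

/-- Verification identity: the payoff with terminal function `(1/2) x' Q_T x` along a curve `Q` of
symmetric matrices. -/
theorem cost_add_eq (p : SwitchedLQ n k M) (hγ : 0 < p.γ) {T : ℝ} (hT : 0 ≤ T)
    {x : EuclideanSpace ℝ (Fin n)} {w : ℝ → EuclideanSpace ℝ (Fin k)} {μ : ℝ → Fin M}
    {ξ : ℝ → EuclideanSpace ℝ (Fin n)} (hw : IsDisturbance w) (hμ : Measurable μ)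
    (h : p.IsTrajectory T x w μ ξ) {Q Q' : ℝ → Matrix (Fin n) (Fin n) ℝ}
    (hQ : ∀ t ∈ Icc 0 T, HasDerivWithinAt Q (Q' t) (Icc 0 T) t) (hQ' : ContinuousOn Q' (Icc 0 T))
    (hsymm : ∀ t ∈ Icc 0 T, (Q t)ᵀ = Q t) :
    p.cost T w μ ξ + 1 / 2 * qform (Q T) (ξ T) = 1 / 2 * qform (Q 0) x +
      ∫ t in (0 : ℝ)..T, (1 / 2 * qform (p.Phi (μ t) (Q t) + Q' t) (ξ t) -
        p.γ ^ 2 / 2 * ‖p.deviation (μ t) (Q t) (ξ t) (w t)‖ ^ 2) := by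
  have hg := p.velocity_memLp hw hμ h.1
  have hQc : ContinuousOn Q (Icc 0 T) := fun t ht => (hQ t ht).continuousWithinAt
  have c1 : ContinuousOn (fun t => mv (Q t) (ξ t)) (Icc 0 T) :=
    ((mv (m := n) (n := n)).continuous.comp_continuousOn hQc).clm_apply h.1
  have c2 : ContinuousOn (fun t => mv (Q' t) (ξ t)) (Icc 0 T) :=
    ((mv (m := n) (n := n)).continuous.comp_continuousOn hQ').clm_apply h.1
  have i1 : IntegrableOn (fun t => 2 * ⟪mv (Q t) (ξ t),
      mv (p.A (μ t)) (ξ t) + mv (p.σ (μ t)) (w t)⟫ + qform (Q' t) (ξ t)) (Icc 0 T) := by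
    refine Integrable.add (((c1.memLp_Icc 2).integrable_real_inner hg).const_mul _) ?_
    simp only [qform_eq_inner]
    exact (h.1.memLp_Icc 2).integrable_real_inner (c2.memLp_Icc 2)
  have i2 := p.cost_integrable hw hμ h.1
  rw [← intervalIntegrable_iff_integrableOn_Icc_of_le hT] at i1 i2
  rw [qform_eq_add_integral hT (hg.intervalIntegrable_of_two hT) h.eq_add_integral hQ hQ' hsymm,
    cost, mul_add, add_left_comm, ← intervalIntegral.integral_const_mul,
    ← intervalIntegral.integral_add i2 (i1.const_mul _)]
  congr 1
  refine intervalIntegral.integral_congr fun t ht => ?_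
  rw [uIcc_of_le hT] at ht
  have := p.hamiltonian_eq hγ (μ t) (hsymm t ht) (ξ t) (w t)
  simp only [qform_add]
  linarith

end SwitchedLQ

/-! ### First-order upper bound for payoffs over a short horizon. -/

theorem qform_le_add {n : ℕ} (P : Matrix (Fin n) (Fin n) ℝ) (x y : EuclideanSpace ℝ (Fin n)) :
    qform P y ≤ qform P x + ‖P‖ * (2 * ‖x‖ * ‖y - x‖ + ‖y - x‖ ^ 2) := by
  set h := y - x with hh
  have hy : y = x + h := by simp [hh]
  have e : qform P y = qform P x + ⟪x, mv P h⟫ + ⟪h, mv P x⟫ + qform P h := by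
    rw [hy]
    simp only [qform_eq_inner, map_add, inner_add_left, inner_add_right]
    ring
  have b1 : ⟪x, mv P h⟫ ≤ ‖x‖ * (‖P‖ * ‖h‖) := by
    refine (real_inner_le_norm _ _).trans ?_
    gcongr; exact norm_mv_le _ _
  have b2 : ⟪h, mv P x⟫ ≤ ‖h‖ * (‖P‖ * ‖x‖) := by
    refine (real_inner_le_norm _ _).trans ?_
    gcongr; exact norm_mv_le _ _
  have b3 := (abs_le.1 (abs_qform_le P h)).2
  rw [e]
  linarith

namespace SwitchedLQ

variable {n k M : ℕ}

theorem exists_coeff_bound (p : SwitchedLQ n k M) : ∃ K : ℝ, 1 ≤ K ∧ ∀ m, ‖p.A m‖ ≤ K ∧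
    ‖(p.A m)ᵀ‖ ≤ K ∧ ‖p.σ m‖ ≤ K ∧ ‖(p.σ m)ᵀ‖ ≤ K ∧ ‖p.D m‖ ≤ K ∧ ‖p.Sig m‖ ≤ K := by
  obtain ⟨K, hK⟩ := Finite.exists_le (fun m => ‖p.A m‖ + ‖(p.A m)ᵀ‖ + ‖p.σ m‖ + ‖(p.σ m)ᵀ‖ +
    ‖p.D m‖ + ‖p.Sig m‖)
  refine ⟨max K 1, le_max_right _ _, fun m => ?_⟩
  have h := (hK m).trans (le_max_left K 1)
  have := norm_nonneg (p.A m)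
  have := norm_nonneg (p.A m)ᵀ
  have := norm_nonneg (p.σ m)
  have := norm_nonneg (p.σ m)ᵀ
  have := norm_nonneg (p.D m)
  have := norm_nonneg (p.Sig m)
  refine ⟨?_, ?_, ?_, ?_, ?_, ?_⟩ <;> linarith

/-- The quadratic part factors as `PΣP - QΣQ = PΣ(P - Q) + (P - Q)ΣQ`. -/
theorem norm_Phi_sub_le (p : SwitchedLQ n k M) {K : ℝ} (hK : 0 ≤ K) (m : Fin M)
    (hA : ‖p.A m‖ ≤ K) (hA' : ‖(p.A m)ᵀ‖ ≤ K) (hS : ‖p.Sig m‖ ≤ K) {R : ℝ}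
    {P Q : Matrix (Fin n) (Fin n) ℝ} (hP : ‖P‖ ≤ R) (hQ : ‖Q‖ ≤ R) :
    ‖p.Phi m P - p.Phi m Q‖ ≤ (2 * K + 2 * K * R) * ‖P - Q‖ := by
  have e : p.Phi m P - p.Phi m Q = (p.A m)ᵀ * (P - Q) + (P - Q) * p.A m +
      P * p.Sig m * (P - Q) + (P - Q) * p.Sig m * Q := by
    simp only [Phi]; noncomm_ring
  have hR : 0 ≤ R := (norm_nonneg _).trans hP
  have b1 : ‖(p.A m)ᵀ * (P - Q)‖ ≤ K * ‖P - Q‖ := (norm_mul_le _ _).trans (by gcongr)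
  have b2 : ‖(P - Q) * p.A m‖ ≤ ‖P - Q‖ * K := (norm_mul_le _ _).trans (by gcongr)
  have b3 : ‖P * p.Sig m * (P - Q)‖ ≤ R * K * ‖P - Q‖ := (norm_mul_le _ _).trans
    (mul_le_mul_of_nonneg_right ((norm_mul_le _ _).trans (by gcongr)) (norm_nonneg _))
  have b4 : ‖(P - Q) * p.Sig m * Q‖ ≤ ‖P - Q‖ * K * R := (norm_mul_le _ _).trans
    (mul_le_mul ((norm_mul_le _ _).trans (by gcongr)) hQ (norm_nonneg _) (by positivity))
  rw [e]
  refine (norm_add_le _ _).trans ?_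
  have := norm_add₃_le (a := (p.A m)ᵀ * (P - Q)) (b := (P - Q) * p.A m)
    (c := P * p.Sig m * (P - Q))
  linarith

theorem norm_Phi_le (p : SwitchedLQ n k M) {K : ℝ} (hK : 0 ≤ K) (m : Fin M)
    (hA : ‖p.A m‖ ≤ K) (hA' : ‖(p.A m)ᵀ‖ ≤ K) (hS : ‖p.Sig m‖ ≤ K) (hD : ‖p.D m‖ ≤ K) {R : ℝ}
    {P : Matrix (Fin n) (Fin n) ℝ} (hP : ‖P‖ ≤ R) :
    ‖p.Phi m P‖ ≤ (2 * K + 2 * K * R) * R + K := by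
  have hR : 0 ≤ R := (norm_nonneg _).trans hP
  have h := p.norm_Phi_sub_le hK m hA hA' hS hP (Q := 0) (by simpa using hR)
  have h0 : p.Phi m 0 = p.D m := by simp [Phi]
  rw [h0, sub_zero] at h
  have h1 : ‖p.Phi m P‖ ≤ ‖p.Phi m P - p.D m‖ + ‖p.D m‖ := by
    simpa using norm_add_le (p.Phi m P - p.D m) (p.D m)
  have h2 : (2 * K + 2 * K * R) * ‖P‖ ≤ (2 * K + 2 * K * R) * R := by gcongr
  linarith

/-- Closed-loop velocity plus a deviation term: the disturbance then enters estimates only through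
the quantity that the payoff penalises. -/
theorem velocity_eq (p : SwitchedLQ n k M) (m : Fin M) (P : Matrix (Fin n) (Fin n) ℝ)
    (x : EuclideanSpace ℝ (Fin n)) (w : EuclideanSpace ℝ (Fin k)) :
    mv (p.A m) x + mv (p.σ m) w =
      mv (p.A m) x + mv (p.σ m) ((1 / p.γ ^ 2) • mv (p.σ m)ᵀ (mv P x)) +
        mv (p.σ m) (p.deviation m P x w) := by
  rw [deviation, map_sub]; abel

theorem norm_velocity_le (p : SwitchedLQ n k M) {K R : ℝ} (hK : 0 ≤ K) (m : Fin M)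
    (hA : ‖p.A m‖ ≤ K) (hσ : ‖p.σ m‖ ≤ K) (hσ' : ‖(p.σ m)ᵀ‖ ≤ K)
    {P : Matrix (Fin n) (Fin n) ℝ} (hP : ‖P‖ ≤ R) (x : EuclideanSpace ℝ (Fin n))
    (w : EuclideanSpace ℝ (Fin k)) :
    ‖mv (p.A m) x + mv (p.σ m) w‖ ≤
      (K + K * (1 / p.γ ^ 2 * (K * R))) * (‖x‖ + ‖p.deviation m P x w‖) := by
  have hR : 0 ≤ R := (norm_nonneg _).trans hP
  rw [p.velocity_eq m P]
  have b1 : ‖mv (p.A m) x‖ ≤ K * ‖x‖ := (norm_mv_le _ _).trans (by gcongr)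
  have b2 : ‖mv (p.σ m) ((1 / p.γ ^ 2) • mv (p.σ m)ᵀ (mv P x))‖ ≤
      K * (1 / p.γ ^ 2 * (K * (R * ‖x‖))) := by
    refine (norm_mv_le _ _).trans (mul_le_mul hσ ?_ (norm_nonneg _) hK)
    rw [norm_smul, Real.norm_of_nonneg (by positivity)]
    gcongr
    refine (norm_mv_le _ _).trans (mul_le_mul hσ' ?_ (norm_nonneg _) hK)
    exact (norm_mv_le _ _).trans (by gcongr)
  have b3 : ‖mv (p.σ m) (p.deviation m P x w)‖ ≤ K * ‖p.deviation m P x w‖ :=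
    (norm_mv_le _ _).trans (by gcongr)
  refine norm_add₃_le.trans ?_
  have : 0 ≤ K * (1 / p.γ ^ 2 * (K * R)) * ‖p.deviation m P x w‖ := by positivity
  linarith

/-- The maximal displacement satisfies `H ≤ K₁(τ|x| + V + τH)`, with `V` the integral of the
deviation norm; since `τ K₁ ≤ 1/2`, the last term is absorbed on the left. This replaces a Gronwall
argument. -/
theorem IsTrajectory.norm_sub_le {p : SwitchedLQ n k M} {K R : ℝ} (hK : 0 ≤ K)
    (hA : ∀ m, ‖p.A m‖ ≤ K) (hσ : ∀ m, ‖p.σ m‖ ≤ K) (hσ' : ∀ m, ‖(p.σ m)ᵀ‖ ≤ K)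
    {P : Matrix (Fin n) (Fin n) ℝ} (hP : ‖P‖ ≤ R) {τ : ℝ} (hτ : 0 < τ)
    (hτK : τ * (K + K * (1 / p.γ ^ 2 * (K * R))) ≤ 1 / 2)
    {x : EuclideanSpace ℝ (Fin n)} {w : ℝ → EuclideanSpace ℝ (Fin k)} {μ : ℝ → Fin M}
    {ξ : ℝ → EuclideanSpace ℝ (Fin n)} (hw : IsDisturbance w) (hμ : Measurable μ)
    (h : p.IsTrajectory τ x w μ ξ) :
    ∀ t ∈ Icc 0 τ, ‖ξ t - x‖ ≤ 2 * (K + K * (1 / p.γ ^ 2 * (K * R))) *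
      (τ * ‖x‖ + ∫ s in (0 : ℝ)..τ, ‖p.deviation (μ s) P (ξ s) (w s)‖) := by
  set K1 := K + K * (1 / p.γ ^ 2 * (K * R)) with hK1
  have hR : 0 ≤ R := (norm_nonneg _).trans hP
  have hK10 : 0 ≤ K1 := by positivity
  obtain ⟨t₀, ht₀, hmax⟩ := isCompact_Icc.exists_isMaxOn (nonempty_Icc.2 hτ.le)
    (h.1.sub (continuousOn_const (c := x))).norm
  set H := ‖ξ t₀ - x‖ with hH
  have hle : ∀ t ∈ Icc 0 τ, ‖ξ t - x‖ ≤ H := fun t ht => hmax ht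
  have hg := p.velocity_memLp hw hμ h.1
  have hv := p.deviation_memLp hw hμ h.1 (continuousOn_const (c := P))
  have hvi := hv.norm.intervalIntegrable_of_two hτ.le
  have hgi := hg.intervalIntegrable_of_two hτ.le
  set V := ∫ s in (0 : ℝ)..τ, ‖p.deviation (μ s) P (ξ s) (w s)‖ with hV
  have hH2 : H ≤ K1 * (τ * ‖x‖ + V + τ * H) := by
    have e1 : ξ t₀ - x = ∫ s in (0 : ℝ)..t₀, (mv (p.A (μ s)) (ξ s) + mv (p.σ (μ s)) (w s)) := by
      rw [h.eq_add_integral t₀ ht₀]; simp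
    calc H ≤ ∫ s in (0 : ℝ)..t₀, ‖mv (p.A (μ s)) (ξ s) + mv (p.σ (μ s)) (w s)‖ := by
          rw [hH, e1]; exact intervalIntegral.norm_integral_le_integral_norm ht₀.1
      _ ≤ ∫ s in (0 : ℝ)..τ, ‖mv (p.A (μ s)) (ξ s) + mv (p.σ (μ s)) (w s)‖ :=
          intervalIntegral.integral_mono_interval le_rfl ht₀.1 ht₀.2
            (.of_forall fun _ => norm_nonneg _) hgi.norm
      _ ≤ ∫ s in (0 : ℝ)..τ, K1 * (‖x‖ + H + ‖p.deviation (μ s) P (ξ s) (w s)‖) := by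
          refine intervalIntegral.integral_mono_on hτ.le hgi.norm
            ((intervalIntegrable_const.add hvi).const_mul _) fun s hs => ?_
          refine (p.norm_velocity_le hK (μ s) (hA _) (hσ _) (hσ' _) hP (ξ s) (w s)).trans ?_
          have : ‖ξ s‖ ≤ ‖x‖ + ‖ξ s - x‖ := by simpa using norm_add_le x (ξ s - x)
          have := hle s hs
          gcongr
          linarith
      _ = K1 * (τ * ‖x‖ + V + τ * H) := by
          rw [intervalIntegral.integral_const_mul,
            intervalIntegral.integral_add intervalIntegrable_const hvi, ← hV,
            intervalIntegral.integral_const, sub_zero, smul_eq_mul]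
          ring
  intro t ht
  refine (hle t ht).trans ?_
  have h0 : 0 ≤ H := norm_nonneg _
  nlinarith [mul_le_mul_of_nonneg_right hτK h0]

/-- First-order upper bound for the payoff over a short horizon, uniformly over disturbances and
switching controls. -/
theorem exists_payoff_le (p : SwitchedLQ n k M) (hγ : 0 < p.γ) (R : ℝ) (hR : 0 ≤ R) :
    ∃ C : ℝ, 0 < C ∧ ∃ τ₁ : ℝ, 0 < τ₁ ∧ ∀ τ : ℝ, 0 < τ → τ ≤ τ₁ →
      ∀ P : Matrix (Fin n) (Fin n) ℝ, Pᵀ = P → ‖P‖ ≤ R → ∀ x w μ ξ, IsDisturbance w →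
      Measurable μ → p.IsTrajectory τ x w μ ξ → ∀ c : ℝ, (∀ m, qform (p.Phi m P) x ≤ c) →
      p.cost τ w μ ξ + 1 / 2 * qform P (ξ τ) ≤
        1 / 2 * qform P x + τ * (1 / 2 * c) + C * τ ^ 2 * ‖x‖ ^ 2 := by
  obtain ⟨K, hK1, hK⟩ := p.exists_coeff_bound
  have hK0 : 0 ≤ K := by linarith
  set K1 := K + K * (1 / p.γ ^ 2 * (K * R)) with hK1d
  set K2 := (2 * K + 2 * K * R) * R + K with hK2d
  have hK1p : 0 < K1 := by positivity
  have hK2p : 0 < K2 := by positivity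
  -- Moving `ξ` to `x` costs at most `3 K1 K2 Y²`, and `Y² ≤ 2τ²|x|² + 2τW` by Cauchy–Schwarz, hence
  -- the factor 6. The first bound on `τ` serves the displacement estimate, the second lets `(γ²/2)
  -- W` absorb `6 K1 K2 τ W`.
  refine ⟨6 * K1 * K2, by positivity, min (1 / (2 * K1)) (p.γ ^ 2 / (12 * K1 * K2)),
    by positivity, ?_⟩
  intro τ hτ hτ1 P hP hPR x w μ ξ hw hμ h c hc
  have hτa : τ * K1 ≤ 1 / 2 := by
    have := hτ1.trans (min_le_left _ _)
    rw [le_div_iff₀ (by positivity)] at this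
    linarith
  have hτb : 6 * K1 * K2 * τ ≤ p.γ ^ 2 / 2 := by
    have := hτ1.trans (min_le_right _ _)
    rw [le_div_iff₀ (by positivity)] at this
    linarith
  have hsub := h.norm_sub_le hK0 (fun m => (hK m).1) (fun m => (hK m).2.2.1)
    (fun m => (hK m).2.2.2.1) hPR hτ hτa hw hμ
  have hv := p.deviation_memLp hw hμ h.1 (continuousOn_const (c := P))
  have hsq := sq_integral_norm_le hτ hv
  have hv2 : IntervalIntegrable (fun t => ‖p.deviation (μ t) P (ξ t) (w t)‖ ^ 2) volume 0 τ :=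
    (intervalIntegrable_iff_integrableOn_Icc_of_le hτ.le).2
      (hv.integrable_norm_pow (p := 2) two_ne_zero)
  set V := ∫ s in (0 : ℝ)..τ, ‖p.deviation (μ s) P (ξ s) (w s)‖ with hV
  set W := ∫ s in (0 : ℝ)..τ, ‖p.deviation (μ s) P (ξ s) (w s)‖ ^ 2 with hW
  have hV0 : 0 ≤ V := intervalIntegral.integral_nonneg hτ.le fun _ _ => norm_nonneg _
  have hW0 : 0 ≤ W := intervalIntegral.integral_nonneg hτ.le fun _ _ => by positivity
  set Y := τ * ‖x‖ + V with hY
  have hY0 : 0 ≤ Y := by positivity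
  set H := 2 * K1 * Y with hH
  -- A frozen `P` works for all modes at once, whereas a Riccati solution would be tied to one mode.
  rw [p.cost_add_eq hγ hτ.le hw hμ h (Q := fun _ => P) (Q' := fun _ => 0)
    (fun t _ => hasDerivWithinAt_const _ _ _) continuousOn_const (fun _ _ => hP)]
  have hint : ∫ t in (0 : ℝ)..τ, (1 / 2 * qform (p.Phi (μ t) P + 0) (ξ t) -
      p.γ ^ 2 / 2 * ‖p.deviation (μ t) P (ξ t) (w t)‖ ^ 2) ≤
      ∫ t in (0 : ℝ)..τ, ((1 / 2 * c + K2 * (‖x‖ * H + H ^ 2 / 2)) -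
        p.γ ^ 2 / 2 * ‖p.deviation (μ t) P (ξ t) (w t)‖ ^ 2) := by
    have i1 : IntervalIntegrable (fun t => qform (p.Phi (μ t) P) (ξ t)) volume 0 τ := by
      refine (intervalIntegrable_iff_integrableOn_Icc_of_le hτ.le).2 ?_
      simp only [qform_eq_inner]
      exact (h.1.memLp_Icc 2).integrable_real_inner
        (memLp_mv_comp (fun m => p.Phi m P) hμ (h.1.memLp_Icc 2))
    refine intervalIntegral.integral_mono_on hτ.le (by
      simp only [add_zero]
      exact (i1.const_mul _).sub (hv2.const_mul _))
      (intervalIntegrable_const.sub (hv2.const_mul _)) fun t ht => ?_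
    obtain ⟨hA, hA', -, -, hD, hS⟩ := hK (μ t)
    have b1 := qform_le_add (p.Phi (μ t) P) x (ξ t)
    have b2 := p.norm_Phi_le hK0 (μ t) hA hA' hS hD hPR
    have b3 := hsub t ht
    have b4 : ‖p.Phi (μ t) P‖ * (2 * ‖x‖ * ‖ξ t - x‖ + ‖ξ t - x‖ ^ 2) ≤
        K2 * (2 * ‖x‖ * H + H ^ 2) := by gcongr
    have b5 := hc (μ t)
    rw [add_zero]
    linarith
  rw [intervalIntegral.integral_sub intervalIntegrable_const (hv2.const_mul _),
    intervalIntegral.integral_const_mul, ← hW, intervalIntegral.integral_const, sub_zero,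
    smul_eq_mul] at hint
  have hY2 : Y ^ 2 ≤ 2 * τ ^ 2 * ‖x‖ ^ 2 + 2 * (τ * W) := by
    have : Y ^ 2 ≤ 2 * (τ * ‖x‖) ^ 2 + 2 * V ^ 2 := by nlinarith [sq_nonneg (τ * ‖x‖ - V)]
    nlinarith
  have a1 : τ * (K2 * (‖x‖ * H)) ≤ 2 * K1 * K2 * Y ^ 2 := by
    have : τ * ‖x‖ ≤ Y := by simp [hY, hV0]
    calc τ * (K2 * (‖x‖ * H)) = 2 * K1 * K2 * (τ * ‖x‖ * Y) := by rw [hH]; ring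
      _ ≤ 2 * K1 * K2 * (Y * Y) := by gcongr
      _ = _ := by ring
  have a2 : τ * (K2 * (H ^ 2 / 2)) ≤ K1 * K2 * Y ^ 2 := by
    calc τ * (K2 * (H ^ 2 / 2)) = (τ * K1) * (2 * K1 * K2 * Y ^ 2) := by rw [hH]; ring
      _ ≤ 1 / 2 * (2 * K1 * K2 * Y ^ 2) := by gcongr
      _ = _ := by ring
  have a3 : 3 * (K1 * K2) * Y ^ 2 ≤ 3 * (K1 * K2) * (2 * τ ^ 2 * ‖x‖ ^ 2 + 2 * (τ * W)) := by
    gcongr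
  have a4 : 6 * K1 * K2 * τ * W ≤ p.γ ^ 2 / 2 * W := by gcongr
  linarith

end SwitchedLQ

/-! ### The Riccati flow and the semigroup of a single mode. -/

/-- The order interval `[εI, λI]`. -/
abbrev loewnerIcc {n : ℕ} (ε lam : ℝ) : Set (Matrix (Fin n) (Fin n) ℝ) :=
  Icc (ε • (1 : Matrix (Fin n) (Fin n) ℝ)) (lam • (1 : Matrix (Fin n) (Fin n) ℝ))

/-- A linear time-varying differential equation is solvable on a short interval. -/
theorem exists_hasDerivWithinAt_linear {E : Type*} [NormedAddCommGroup E] [NormedSpace ℝ E]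
    [CompleteSpace E] {T κ : ℝ} (hT : 0 ≤ T) (hκ : 0 ≤ κ) (hκT : κ * T ≤ 1 / 2)
    {G : ℝ → E →L[ℝ] E} (hG : ContinuousOn G (Icc 0 T)) (hGκ : ∀ t ∈ Icc 0 T, ‖G t‖ ≤ κ) (x : E) :
    ∃ ξ : ℝ → E, ξ 0 = x ∧ ∀ t ∈ Icc 0 T, HasDerivWithinAt ξ (G t (ξ t)) (Icc 0 T) t := by
  lift κ to NNReal using hκ
  have hx : ∀ y ∈ Metric.closedBall x ‖x‖₊, ‖y‖ ≤ 2 * ‖x‖ := by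
    intro y hy
    rw [mem_closedBall_iff_norm] at hy
    have : ‖y‖ ≤ ‖x‖ + ‖y - x‖ := by simpa using norm_add_le x (y - x)
    simp only [coe_nnnorm] at hy
    linarith
  -- In the ball of radius `‖x‖` about `x` the speed is at most `2κ‖x‖`, and `κT ≤ 1/2` keeps the
  -- solution in that ball.
  have hP : IsPicardLindelof (fun t y => G t y) (⟨0, le_rfl, hT⟩ : Icc 0 T) x ‖x‖₊ 0
      (κ * (2 * ‖x‖₊)) κ := by
    constructor
    · intro t ht
      exact ((G t).lipschitz.weaken (hGκ t ht)).lipschitzOnWith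
    · intro y _
      exact hG.clm_apply continuousOn_const
    · intro t ht y hy
      have := ((G t).le_opNorm y).trans (mul_le_mul (hGκ t ht) (hx y hy) (norm_nonneg _) κ.2)
      simpa using this
    · have h2 := mul_le_mul_of_nonneg_right hκT (norm_nonneg x)
      simp only [sub_zero, sub_self, max_eq_left hT, NNReal.coe_mul, coe_nnnorm,
        NNReal.coe_zero, NNReal.coe_ofNat]
      linarith
  exact hP.exists_eq_forall_mem_Icc_hasDerivWithinAt₀

namespace SwitchedLQ

variable {n k M : ℕ}

/-- The field is quadratic, hence only locally Lipschitz; two continuous solutions on a compact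
interval share a ball on which it is Lipschitz. -/
theorem riccati_unique (p : SwitchedLQ n k M) (m : Fin M) {T : ℝ}
    {P Q : ℝ → Matrix (Fin n) (Fin n) ℝ}
    (hP : ∀ s ∈ Icc 0 T, HasDerivWithinAt P (p.Phi m (P s)) (Icc 0 T) s)
    (hQ : ∀ s ∈ Icc 0 T, HasDerivWithinAt Q (p.Phi m (Q s)) (Icc 0 T) s) (h0 : P 0 = Q 0) :
    EqOn P Q (Icc 0 T) := by
  have hPc : ContinuousOn P (Icc 0 T) := fun t ht => (hP t ht).continuousWithinAt
  have hQc : ContinuousOn Q (Icc 0 T) := fun t ht => (hQ t ht).continuousWithinAt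
  obtain ⟨R₁, hR₁⟩ := isCompact_Icc.exists_bound_of_continuousOn hPc
  obtain ⟨R₂, hR₂⟩ := isCompact_Icc.exists_bound_of_continuousOn hQc
  obtain ⟨K, hK1, hK⟩ := p.exists_coeff_bound
  have hK0 : 0 ≤ K := by linarith
  set R := max (max R₁ R₂) 0 with hR
  have hR0 : 0 ≤ R := le_max_right _ _
  refine ODE_solution_unique_of_mem_Icc_right (v := fun _ => p.Phi m)
    (s := fun _ => Metric.closedBall 0 R) (K := ⟨2 * K + 2 * K * R, by positivity⟩) ?_ hPc ?_ ?_
    hQc ?_ ?_ h0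
  · intro t _
    refine LipschitzOnWith.of_dist_le_mul fun X hX Y hY => ?_
    rw [dist_eq_norm, dist_eq_norm]
    exact p.norm_Phi_sub_le hK0 m (hK m).1 (hK m).2.1 (hK m).2.2.2.2.2
      (mem_closedBall_zero_iff.1 hX) (mem_closedBall_zero_iff.1 hY)
  · intro t ht
    exact (hP t ⟨ht.1, ht.2.le⟩).mono_of_mem_nhdsWithin (Icc_mem_nhdsGE_of_mem ht)
  · intro t ht
    exact mem_closedBall_zero_iff.2 ((hR₁ t ⟨ht.1, ht.2.le⟩).trans
      ((le_max_left _ _).trans (le_max_left _ _)))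
  · intro t ht
    exact (hQ t ⟨ht.1, ht.2.le⟩).mono_of_mem_nhdsWithin (Icc_mem_nhdsGE_of_mem ht)
  · intro t ht
    exact mem_closedBall_zero_iff.2 ((hR₂ t ⟨ht.1, ht.2.le⟩).trans
      ((le_max_right _ _).trans (le_max_left _ _)))

/-- On an invariant interval the Riccati flow stays in the interval at intermediate times. -/
theorem IsInvariantInterval.exists_solution {p : SwitchedLQ n k M} {ε lam : ℝ}
    (h : p.IsInvariantInterval ε lam) (m : Fin M) {T : ℝ} (hT : 0 ≤ T)
    {P₀ : Matrix (Fin n) (Fin n) ℝ} (hP₀ : P₀ ∈ loewnerIcc ε lam) :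
    ∃ P : ℝ → Matrix (Fin n) (Fin n) ℝ, P 0 = P₀ ∧
      (∀ s ∈ Icc 0 T, HasDerivWithinAt P (p.Phi m (P s)) (Icc 0 T) s) ∧
      ∀ s ∈ Icc 0 T, P s ∈ loewnerIcc ε lam := by
  obtain ⟨Q, hQ, P, h0, hd, hT'⟩ := h m T hT P₀ hP₀
  refine ⟨P, h0, hd, fun s hs => ?_⟩
  -- Invariance speaks only of the final time, so it is applied again with horizon `s`; uniqueness
  -- identifies the two solutions.
  obtain ⟨Q', hQ', P', h0', hd', hs'⟩ := h m s hs.1 P₀ hP₀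
  have hsub : Icc 0 s ⊆ Icc 0 T := Icc_subset_Icc_right hs.2
  have := p.riccati_unique m (fun r hr => (hd r (hsub hr)).mono hsub) hd' (h0.trans h0'.symm)
    ⟨hs.1, le_rfl⟩
  rw [this, hs']
  exact hQ'

/-- First-order lower bound for the Riccati flow over a short horizon. -/
theorem exists_riccati_ge (p : SwitchedLQ n k M) {R : ℝ} (hR : 0 ≤ R) :
    ∃ C : ℝ, 0 ≤ C ∧ ∀ (m : Fin M) (τ : ℝ), 0 ≤ τ → ∀ P : ℝ → Matrix (Fin n) (Fin n) ℝ,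
      (∀ s ∈ Icc 0 τ, HasDerivWithinAt P (p.Phi m (P s)) (Icc 0 τ) s) →
      (∀ s ∈ Icc 0 τ, ‖P s‖ ≤ R) → ∀ x,
      qform (P 0) x + τ * qform (p.Phi m (P 0)) x ≤ qform (P τ) x + C * τ ^ 2 * ‖x‖ ^ 2 := by
  obtain ⟨K, hK1, hK⟩ := p.exists_coeff_bound
  have hK0 : 0 ≤ K := by linarith
  set B := (2 * K + 2 * K * R) * R + K with hB
  refine ⟨(2 * K + 2 * K * R) * B, by positivity, fun m τ hτ P hP hPR x => ?_⟩
  obtain ⟨hA, hA', -, -, hD, hS⟩ := hK m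
  have h0 : (0 : ℝ) ∈ Icc 0 τ := ⟨le_rfl, hτ⟩
  have hτ' : τ ∈ Icc 0 τ := ⟨hτ, le_rfl⟩
  have h1 : ∀ s ∈ Icc 0 τ, ‖P s - P 0‖ ≤ B * τ := by
    intro s hs
    refine ((convex_Icc 0 τ).norm_image_sub_le_of_norm_hasDerivWithin_le hP
      (fun r hr => p.norm_Phi_le hK0 m hA hA' hS hD (hPR r hr)) h0 hs).trans ?_
    rw [sub_zero, Real.norm_of_nonneg hs.1]
    exact mul_le_mul_of_nonneg_left hs.2 (by positivity)
  -- After subtraction of the linear term the derivative is `O(τ)`, so the increment over the step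
  -- is `O(τ²)`.
  have h2 : ∀ s ∈ Icc 0 τ, HasDerivWithinAt (fun s => P s - s • p.Phi m (P 0))
      (p.Phi m (P s) - p.Phi m (P 0)) (Icc 0 τ) s := by
    intro s hs
    have := (hP s hs).sub ((hasDerivWithinAt_id s (Icc 0 τ)).smul_const (p.Phi m (P 0)))
    rwa [one_smul] at this
  have h3 := (convex_Icc 0 τ).norm_image_sub_le_of_norm_hasDerivWithin_le h2
    (C := (2 * K + 2 * K * R) * (B * τ)) (fun r hr =>
      (p.norm_Phi_sub_le hK0 m hA hA' hS (hPR r hr) (hPR 0 h0)).trans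
        (mul_le_mul_of_nonneg_left (h1 r hr) (by positivity))) h0 hτ'
  rw [sub_zero, Real.norm_of_nonneg hτ, zero_smul, sub_zero] at h3
  have h4 := (abs_le.1 (abs_qform_le (P τ - τ • p.Phi m (P 0) - P 0) x)).1
  rw [qform_sub, qform_sub, qform_smul] at h4
  have h5 := mul_le_mul_of_nonneg_right h3 (sq_nonneg ‖x‖)
  linarith

theorem payoff_quadFun (p : SwitchedLQ n k M) (T : ℝ) (P : Matrix (Fin n) (Fin n) ℝ)
    (w : ℝ → EuclideanSpace ℝ (Fin k)) (μ : ℝ → Fin M) (ξ : ℝ → EuclideanSpace ℝ (Fin n)) :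
    p.payoff T (quadFun P) w μ ξ = ((p.cost T w μ ξ + 1 / 2 * qform P (ξ T) : ℝ) : EReal) := by
  rw [payoff, quadFun, ← EReal.coe_add, cost]

/-- Along a Riccati solution the verification identity has only the deviation term. -/
theorem cost_add_eq_of_riccati (p : SwitchedLQ n k M) (hγ : 0 < p.γ) (m : Fin M) {τ : ℝ}
    (hτ : 0 ≤ τ) {P : ℝ → Matrix (Fin n) (Fin n) ℝ}
    (hP : ∀ s ∈ Icc 0 τ, HasDerivWithinAt P (p.Phi m (P s)) (Icc 0 τ) s)
    (hsymm : ∀ s ∈ Icc 0 τ, (P s)ᵀ = P s) {x : EuclideanSpace ℝ (Fin n)}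
    {w : ℝ → EuclideanSpace ℝ (Fin k)} {ξ : ℝ → EuclideanSpace ℝ (Fin n)}
    (hw : IsDisturbance w) (h : p.IsTrajectory τ x w (fun _ => m) ξ) :
    p.cost τ w (fun _ => m) ξ + 1 / 2 * qform (P 0) (ξ τ) = 1 / 2 * qform (P τ) x -
      p.γ ^ 2 / 2 * ∫ t in (0 : ℝ)..τ, ‖p.deviation m (P (τ - t)) (ξ t) (w t)‖ ^ 2 := by
  have hmaps : MapsTo (fun t => τ - t) (Icc 0 τ) (Icc 0 τ) := fun t ht =>
    ⟨sub_nonneg.2 ht.2, sub_le_self _ ht.1⟩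
  have hPc : ContinuousOn P (Icc 0 τ) := fun t ht => (hP t ht).continuousWithinAt
  have hQc : ContinuousOn (fun t => P (τ - t)) (Icc 0 τ) :=
    hPc.comp (continuousOn_const.sub continuousOn_id) hmaps
  -- The time-reversed solution satisfies `Q' = -Φ(Q)`, which cancels the quadratic term of the
  -- verification identity.
  have := p.cost_add_eq hγ hτ hw measurable_const h (Q := fun t => P (τ - t))
    (Q' := fun t => -p.Phi m (P (τ - t))) (fun t ht => by
      have h1 := (hP (τ - t) (hmaps ht)).scomp t
        ((hasDerivWithinAt_const t (Icc 0 τ) τ).sub (hasDerivWithinAt_id t (Icc 0 τ))) hmaps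
      rw [zero_sub, neg_smul, one_smul] at h1
      exact h1) (by
      simp only [Phi]
      fun_prop) (fun t ht => hsymm _ (hmaps ht))
  simp only [sub_self, sub_zero, add_neg_cancel] at this
  rw [this, ← intervalIntegral.integral_const_mul, sub_eq_add_neg,
    ← intervalIntegral.integral_neg]
  congr 2
  funext t
  simp [qform_eq_inner]

/-- Existence of the closed-loop trajectory of a mode over a short horizon. -/
theorem exists_closed_loop (p : SwitchedLQ n k M) (m : Fin M) {τ κ : ℝ}
    (hτ : 0 ≤ τ) (hκ : 0 ≤ κ) (hκτ : κ * τ ≤ 1 / 2) {P : ℝ → Matrix (Fin n) (Fin n) ℝ}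
    (hP : ContinuousOn P (Icc 0 τ)) (hPκ : ∀ s ∈ Icc 0 τ, ‖p.A m + p.Sig m * P s‖ ≤ κ)
    (x : EuclideanSpace ℝ (Fin n)) :
    ∃ w ξ, IsDisturbance w ∧ p.IsTrajectory τ x w (fun _ => m) ξ ∧
      ∀ t ∈ Icc 0 τ, p.deviation m (P (τ - t)) (ξ t) (w t) = 0 := by
  have hmaps : MapsTo (fun t => τ - t) (Icc 0 τ) (Icc 0 τ) := fun t ht =>
    ⟨sub_nonneg.2 ht.2, sub_le_self _ ht.1⟩
  have hQc : ContinuousOn (fun t => P (τ - t)) (Icc 0 τ) :=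
    hP.comp (continuousOn_const.sub continuousOn_id) hmaps
  have hGc : ContinuousOn (fun t => mv (p.A m + p.Sig m * P (τ - t))) (Icc 0 τ) :=
    (mv (m := n) (n := n)).continuous.comp_continuousOn (by fun_prop)
  obtain ⟨ξ, h0, hd⟩ := exists_hasDerivWithinAt_linear hτ hκ hκτ hGc (fun t ht =>
    (ContinuousLinearMap.opNorm_le_bound _ (norm_nonneg _) (norm_mv_le _)).trans
      (hPκ _ (hmaps ht))) x
  have hξ : ContinuousOn ξ (Icc 0 τ) := fun t ht => (hd t ht).continuousWithinAt
  set u : ℝ → EuclideanSpace ℝ (Fin k) :=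
    fun t => (1 / p.γ ^ 2) • mv (p.σ m)ᵀ (mv (P (τ - t)) (ξ t)) with hu
  have huc : ContinuousOn u (Icc 0 τ) := by
    have : ContinuousOn (fun t => mv (P (τ - t)) (ξ t)) (Icc 0 τ) :=
      ((mv (m := n) (n := n)).continuous.comp_continuousOn hQc).clm_apply hξ
    exact ContinuousOn.const_smul ((mv (p.σ m)ᵀ).continuous.comp_continuousOn this)
      (1 / p.γ ^ 2)
  have hvel : ∀ t, mv (p.A m + p.Sig m * P (τ - t)) (ξ t) =
      mv (p.A m) (ξ t) + mv (p.σ m) (u t) := by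
    intro t
    simp only [hu, map_add, add_apply, mv_mul, Sig, map_smul, smul_apply]
  -- The feedback is cut off outside `Icc 0 τ`, where nothing is known about `P`, to be square
  -- integrable on every interval.
  have hwu : ∀ t ∈ Icc 0 τ, (Icc 0 τ).indicator u t = u t := fun t ht => indicator_of_mem ht u
  refine ⟨(Icc 0 τ).indicator u, ξ, fun T => ?_, ⟨hξ, fun t ht => ?_⟩, fun t ht => ?_⟩
  · exact ((memLp_indicator_iff_restrict measurableSet_Icc).2 (huc.memLp_Icc 2)).restrict _
  · have hsub : Icc 0 t ⊆ Icc 0 τ := Icc_subset_Icc_right ht.2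
    have hvc : ContinuousOn (fun s => mv (p.A m + p.Sig m * P (τ - s)) (ξ s)) (Icc 0 τ) :=
      hGc.clm_apply hξ
    have hftc := intervalIntegral.integral_eq_sub_of_hasDerivAt_of_le ht.1 (hξ.mono hsub)
      (fun s hs => (hd s (hsub (Ioo_subset_Icc_self hs))).hasDerivAt
        (Icc_mem_nhds hs.1 (hs.2.trans_le ht.2)))
      ((hvc.mono hsub).intervalIntegrable_of_Icc ht.1)
    rw [h0, eq_sub_iff_add_eq'] at hftc
    rw [← hftc]
    congr 1
    refine intervalIntegral.integral_congr fun s hs => ?_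
    rw [uIcc_of_le ht.1] at hs
    simp only [hvel, hwu s (hsub hs)]
    rfl
  · rw [deviation, hwu t ht, hu]
    exact sub_self _

/-- On an invariant interval and for short horizons, the semigroup of a mode acts on quadratic
functions by the Riccati flow. -/
theorem exists_Sm_eq (p : SwitchedLQ n k M) (hγ : 0 < p.γ) {R : ℝ} (hR : 0 ≤ R) :
    ∃ τ₁ : ℝ, 0 < τ₁ ∧ ∀ (m : Fin M) (τ : ℝ), 0 ≤ τ → τ ≤ τ₁ →
      ∀ P : ℝ → Matrix (Fin n) (Fin n) ℝ,
      (∀ s ∈ Icc 0 τ, HasDerivWithinAt P (p.Phi m (P s)) (Icc 0 τ) s) →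
      (∀ s ∈ Icc 0 τ, (P s)ᵀ = P s) → (∀ s ∈ Icc 0 τ, ‖P s‖ ≤ R) →
      p.Sm m τ (quadFun (P 0)) = quadFun (P τ) := by
  obtain ⟨K, hK1, hK⟩ := p.exists_coeff_bound
  have hK0 : 0 ≤ K := by linarith
  refine ⟨1 / (2 * (K + K * R)), by positivity, fun m τ hτ hτ1 P hP hsymm hPR => ?_⟩
  rw [le_div_iff₀ (by positivity)] at hτ1
  funext x
  apply le_antisymm
  · refine sSup_le ?_
    rintro v ⟨w, ξ, hw, hξ, rfl⟩
    rw [payoff_quadFun, quadFun, EReal.coe_le_coe_iff,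
      p.cost_add_eq_of_riccati hγ m hτ hP hsymm hw hξ, sub_le_self_iff]
    exact mul_nonneg (by positivity)
      (intervalIntegral.integral_nonneg hτ fun _ _ => by positivity)
  · obtain ⟨w, ξ, hw, hξ, hdev⟩ := p.exists_closed_loop m hτ (κ := K + K * R) (by positivity)
      (by linarith) (fun t ht => (hP t ht).continuousWithinAt) (fun s hs => by
        refine (norm_add_le _ _).trans (add_le_add (hK m).1 ((norm_mul_le _ _).trans ?_))
        exact mul_le_mul (hK m).2.2.2.2.2 (hPR s hs) (norm_nonneg _) hK0) x
    refine le_sSup_of_le ⟨w, ξ, hw, hξ, rfl⟩ ?_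
    rw [payoff_quadFun, quadFun, EReal.coe_le_coe_iff,
      p.cost_add_eq_of_riccati hγ m hτ hP hsymm hw hξ]
    have : ∫ t in (0 : ℝ)..τ, ‖p.deviation m (P (τ - t)) (ξ t) (w t)‖ ^ 2 = 0 := by
      rw [intervalIntegral.integral_congr (g := fun _ => 0)]
      · simp
      · intro t ht
        rw [uIcc_of_le hτ] at ht
        simp [hdev t ht]
    rw [this]; simp

end SwitchedLQ

namespace SwitchedLQ

variable {n k M : ℕ}

/-! ### Splitting trajectories and costs at an intermediate time. -/

section DynamicProgramming

theorem IsDisturbance.shift {w : ℝ → EuclideanSpace ℝ (Fin k)} (hw : IsDisturbance w) {a : ℝ}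
    (ha : 0 ≤ a) : IsDisturbance fun t => w (t + a) := by
  intro T
  have h1 : MemLp w 2 (volume.restrict (Icc a (T + a))) :=
    (hw (T + a)).mono_measure (Measure.restrict_mono (Icc_subset_Icc_left ha) le_rfl)
  have h2 := (measurePreserving_add_right (volume : Measure ℝ) a).restrict_preimage
    (measurableSet_Icc (a := a) (b := T + a))
  have h3 : (fun t => t + a) ⁻¹' Icc a (T + a) = Icc 0 T := by
    ext t; simp
  rw [h3] at h2
  exact h1.comp_measurePreserving h2

theorem IsTrajectory.mono {p : SwitchedLQ n k M} {a T : ℝ} (haT : a ≤ T)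
    {x : EuclideanSpace ℝ (Fin n)} {w : ℝ → EuclideanSpace ℝ (Fin k)} {μ : ℝ → Fin M}
    {ξ : ℝ → EuclideanSpace ℝ (Fin n)} (h : p.IsTrajectory T x w μ ξ) :
    p.IsTrajectory a x w μ ξ :=
  ⟨h.1.mono (Icc_subset_Icc_right haT), fun t ht => h.2 t (Icc_subset_Icc_right haT ht)⟩

theorem IsTrajectory.shift {p : SwitchedLQ n k M} {a T : ℝ} (ha : 0 ≤ a)
    {x : EuclideanSpace ℝ (Fin n)} {w : ℝ → EuclideanSpace ℝ (Fin k)} {μ : ℝ → Fin M}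
    {ξ : ℝ → EuclideanSpace ℝ (Fin n)} (hw : IsDisturbance w) (hμ : Measurable μ)
    (h : p.IsTrajectory (a + T) x w μ ξ) :
    p.IsTrajectory T (ξ a) (fun t => w (t + a)) (fun t => μ (t + a)) fun t => ξ (t + a) := by
  have hmem : ∀ t ∈ Icc 0 T, t + a ∈ Icc 0 (a + T) := fun t ht =>
    ⟨add_nonneg ht.1 ha, by linarith [ht.2]⟩
  refine ⟨h.1.comp (by fun_prop) hmem, fun t ht => ?_⟩
  have hg := p.velocity_memLp hw hμ h.1
  have haT : 0 ≤ a + T := (hmem t ht).1.trans (hmem t ht).2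
  have hgi := hg.intervalIntegrable_of_two haT
  have hsub : ∀ s ∈ Icc 0 (a + T), IntervalIntegrable
      (fun t => mv (p.A (μ t)) (ξ t) + mv (p.σ (μ t)) (w t)) volume 0 s := fun s hs =>
    hgi.mono_set (by
      rw [uIcc_of_le haT]; exact uIcc_subset_Icc ⟨le_rfl, haT⟩ hs)
  have ham : a ∈ Icc 0 (a + T) := ⟨ha, by linarith [ht.1.trans ht.2]⟩
  have e : ξ (t + a) = ξ a + ∫ s in (0 : ℝ)..t, (mv (p.A (μ (s + a))) (ξ (s + a)) +
      mv (p.σ (μ (s + a))) (w (s + a))) := by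
    rw [intervalIntegral.integral_comp_add_right
      (fun s => mv (p.A (μ s)) (ξ s) + mv (p.σ (μ s)) (w s)), zero_add,
      ← intervalIntegral.integral_interval_sub_left (hsub _ (hmem t ht)) (hsub a ham),
      h.eq_add_integral _ (hmem t ht), h.eq_add_integral a ham]
    abel
  exact e

theorem cost_add (p : SwitchedLQ n k M) {a T : ℝ} (ha : 0 ≤ a) (hT : 0 ≤ T)
    {w : ℝ → EuclideanSpace ℝ (Fin k)} {μ : ℝ → Fin M}
    {ξ : ℝ → EuclideanSpace ℝ (Fin n)} (hw : IsDisturbance w) (hμ : Measurable μ)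
    (hξ : ContinuousOn ξ (Icc 0 (a + T))) :
    p.cost (a + T) w μ ξ = p.cost a w μ ξ +
      p.cost T (fun t => w (t + a)) (fun t => μ (t + a)) fun t => ξ (t + a) := by
  have hi := (intervalIntegrable_iff_integrableOn_Icc_of_le (add_nonneg ha hT)).2
    (p.cost_integrable hw hμ hξ)
  have hsub : ∀ s ∈ Icc 0 (a + T), ∀ t ∈ Icc 0 (a + T), IntervalIntegrable
      (fun t => 1 / 2 * qform (p.D (μ t)) (ξ t) - p.γ ^ 2 / 2 * ‖w t‖ ^ 2) volume s t :=
    fun s hs t ht => hi.mono_set (by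
      rw [uIcc_of_le (add_nonneg ha hT)]; exact uIcc_subset_Icc hs ht)
  have h0 : (0 : ℝ) ∈ Icc 0 (a + T) := ⟨le_rfl, add_nonneg ha hT⟩
  have h1 : a ∈ Icc 0 (a + T) := ⟨ha, by linarith⟩
  have h2 : a + T ∈ Icc 0 (a + T) := ⟨add_nonneg ha hT, le_rfl⟩
  simp only [cost]
  rw [intervalIntegral.integral_comp_add_right
    (fun t => 1 / 2 * qform (p.D (μ t)) (ξ t) - p.γ ^ 2 / 2 * ‖w t‖ ^ 2), zero_add, add_comm T a,
    intervalIntegral.integral_add_adjacent_intervals (hsub _ h0 _ h1) (hsub _ h1 _ h2)]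

/-- The undisturbed trajectory of a mode. -/
theorem exists_trajectory (p : SwitchedLQ n k M) (m : Fin M) (T : ℝ)
    (x : EuclideanSpace ℝ (Fin n)) :
    ∃ w ξ, IsDisturbance w ∧ p.IsTrajectory T x w (fun _ => m) ξ := by
  set ξ : ℝ → EuclideanSpace ℝ (Fin n) := fun t => NormedSpace.exp (t • mv (p.A m)) x with hξ
  have hd : ∀ t, HasDerivAt ξ (mv (p.A m) (ξ t)) t := fun t =>
    (ContinuousLinearMap.apply ℝ (EuclideanSpace ℝ (Fin n)) x).hasFDerivAt.comp_hasDerivAt t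
      (hasDerivAt_exp_smul_const' (𝕂 := ℝ) (mv (p.A m)) t)
  have hc : Continuous ξ := continuous_iff_continuousAt.2 fun t => (hd t).continuousAt
  refine ⟨fun _ => 0, ξ, fun _ => MemLp.zero, hc.continuousOn, fun t _ => ?_⟩
  have hi : IntervalIntegrable (fun s => mv (p.A m) (ξ s)) volume 0 t :=
    ((mv (p.A m)).continuous.comp hc).intervalIntegrable _ _
  have := intervalIntegral.integral_eq_sub_of_hasDerivAt (fun s _ => hd s) hi
  have h0 : ξ 0 = x := by
    have h1 : ∀ B : EuclideanSpace ℝ (Fin n) →L[ℝ] EuclideanSpace ℝ (Fin n),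
        NormedSpace.exp ((0 : ℝ) • B) = 1 := fun B => by
      rw [zero_smul ℝ B, NormedSpace.exp_zero]
    simp only [hξ]
    rw [h1]
    rfl
  rw [h0, eq_sub_iff_add_eq'] at this
  rw [← this]
  simp [mv_apply]

end DynamicProgramming

/-! ### Contraction of the relative error over one step. -/

section OneStep

theorem Assumption2.lam2_pos {p : SwitchedLQ n k M} {cA cσ cD mD : ℝ}
    (h1 : p.Assumption1 cA cσ cD) (h2 : p.Assumption2 cA cσ cD mD) : 0 < p.lam2 cσ mD := by
  have := h1.γ_pos
  have := h1.cσ_pos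
  have := h2.mD_pos
  exact Real.sqrt_pos.2 (by positivity)

theorem loewnerIcc_mono {ε lam lam' : ℝ} (h : lam ≤ lam') :
    (loewnerIcc ε lam : Set (Matrix (Fin n) (Fin n) ℝ)) ⊆ loewnerIcc ε lam' := by
  intro P hP
  rw [mem_Icc_smul_one_iff] at hP ⊢
  exact ⟨hP.1, fun x => ⟨(hP.2 x).1, (hP.2 x).2.trans (by gcongr)⟩⟩

/-- Strict subhomogeneity of the Riccati vector field below the threshold `λ₂`. -/
theorem qform_Phi_smul_le (p : SwitchedLQ n k M) (m : Fin M) {cσ mD Λ b η θ : ℝ} (hcσ : 0 ≤ cσ)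
    (hσ : ‖p.σ m‖ ≤ cσ) {x : EuclideanSpace ℝ (Fin n)} (hD : mD * ‖x‖ ^ 2 ≤ qform (p.D m) x)
    {P : Matrix (Fin n) (Fin n) ℝ} (hP : Pᵀ = P) (hPΛ : ‖P‖ ≤ Λ)
    (hb : b = 1 / p.γ ^ 2 * (cσ * Λ) ^ 2) (hθ : 0 ≤ θ) (hη : (1 + θ) * b + η ≤ mD) :
    qform (p.Phi m ((1 + θ) • P)) x ≤ (1 + θ) * qform (p.Phi m P) x - θ * η * ‖x‖ ^ 2 := by
  have hP' : ((1 + θ) • P)ᵀ = (1 + θ) • P := by rw [Matrix.transpose_smul, hP]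
  rw [p.qform_Phi m hP, p.qform_Phi m hP']
  simp only [map_smul, smul_apply, inner_smul_left, norm_smul, Real.norm_of_nonneg
    (add_nonneg zero_le_one hθ), mul_pow, RCLike.conj_to_real]
  have hn : ‖mv (p.σ m)ᵀ (mv P x)‖ ≤ cσ * Λ * ‖x‖ := by
    have hσ' : ‖(p.σ m)ᵀ‖ ≤ cσ := by
      rw [← Matrix.conjTranspose_eq_transpose_of_trivial, Matrix.l2_opNorm_conjTranspose]
      exact hσ
    refine (norm_mv_le _ _).trans ?_
    rw [mul_assoc]
    exact mul_le_mul hσ' ((norm_mv_le _ _).trans (by gcongr)) (norm_nonneg _) hcσ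
  have hs : 1 / p.γ ^ 2 * ‖mv (p.σ m)ᵀ (mv P x)‖ ^ 2 ≤ b * ‖x‖ ^ 2 := by
    rw [hb, mul_assoc, ← mul_pow]
    gcongr
  set s := 1 / p.γ ^ 2 * ‖mv (p.σ m)ᵀ (mv P x)‖ ^ 2 with hsd
  -- Multiplied by `θ`, this is the asserted inequality: the two sides without the `η` term differ
  -- by `θ((1 + θ)s - x'Dx)`.
  have h3 : (1 + θ) * s + η * ‖x‖ ^ 2 ≤ qform (p.D m) x := by
    have h4 := mul_le_mul_of_nonneg_right hη (sq_nonneg ‖x‖)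
    have h5 := mul_le_mul_of_nonneg_left hs (by linarith : 0 ≤ 1 + θ)
    linarith
  have h6 := mul_le_mul_of_nonneg_left h3 hθ
  have e : 1 / p.γ ^ 2 * ((1 + θ) ^ 2 * ‖mv (p.σ m)ᵀ (mv P x)‖ ^ 2) = (1 + θ) ^ 2 * s := by
    rw [hsd]; ring
  rw [e]
  linarith

/-- One step of the mode semigroups on the invariant interval. -/
theorem IsInvariantInterval.exists_step {p : SwitchedLQ n k M} (hγ : 0 < p.γ) {ε lam Λ : ℝ}
    (hε : 0 ≤ ε) (hΛ : 0 < Λ) (hlam : lam ≤ Λ) (hinv : p.IsInvariantInterval ε lam) :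
    ∃ C : ℝ, 0 ≤ C ∧ ∃ τ₁ : ℝ, 0 < τ₁ ∧ ∀ τ : ℝ, 0 ≤ τ → τ ≤ τ₁ → ∀ m : Fin M,
      ∀ P ∈ loewnerIcc ε lam, ∃ Q ∈ loewnerIcc ε lam, p.Sm m τ (quadFun P) = quadFun Q ∧
        ∀ x, qform P x + τ * qform (p.Phi m P) x ≤ qform Q x + C * τ ^ 2 * ‖x‖ ^ 2 := by
  obtain ⟨C, hC, hlow⟩ := p.exists_riccati_ge hΛ.le
  obtain ⟨τ₁, hτ₁, hSm⟩ := p.exists_Sm_eq hγ hΛ.le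
  refine ⟨C, hC, τ₁, hτ₁, fun τ hτ hτ' m P hP => ?_⟩
  obtain ⟨X, rfl, hd, hX⟩ := hinv.exists_solution m hτ hP
  have hsymm : ∀ s ∈ Icc 0 τ, (X s)ᵀ = X s := fun s hs => (mem_Icc_smul_one_iff.1 (hX s hs)).1
  have hn : ∀ s ∈ Icc 0 τ, ‖X s‖ ≤ Λ := fun s hs =>
    norm_le_of_mem_Icc hε hΛ (loewnerIcc_mono hlam (hX s hs))
  exact ⟨X τ, hX τ ⟨hτ, le_rfl⟩, hSm m τ hτ hτ' X hd hsymm hn, hlow m τ hτ X hd hn⟩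

/-- One step contracts the relative error up to a quadratic term in the step size. -/
theorem exists_one_step (hM : 0 < M) (p : SwitchedLQ n k M) {cA cσ cD mD : ℝ}
    (h1 : p.Assumption1 cA cσ cD) (h2 : p.Assumption2 cA cσ cD mD) {ε lam Λ : ℝ} (hε : 0 < ε)
    (hΛ : 0 < Λ) (hΛ2 : Λ < p.lam2 cσ mD) (hlam : lam ≤ Λ) (hinv : p.IsInvariantInterval ε lam) :
    ∃ α : ℝ, 0 < α ∧ ∃ C : ℝ, 0 < C ∧ ∃ θ₁ : ℝ, 0 < θ₁ ∧ ∃ τ₁ : ℝ, 0 < τ₁ ∧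
      ∀ τ : ℝ, 0 < τ → τ ≤ τ₁ → ∀ P ∈ loewnerIcc ε lam,
        (∀ m, ∃ Q ∈ loewnerIcc ε lam, p.Sm m τ (quadFun P) = quadFun Q) ∧
        ∀ θ : ℝ, 0 ≤ θ → θ ≤ θ₁ → ∀ x w μ ξ, IsDisturbance w → Measurable μ →
          p.IsTrajectory τ x w μ ξ → ∃ m, ∃ Q ∈ loewnerIcc ε lam,
            p.Sm m τ (quadFun P) = quadFun Q ∧
            p.cost τ w μ ξ + (1 + θ) * (1 / 2 * qform P (ξ τ)) ≤
              (1 + θ * (1 - α * τ) + C * τ ^ 2) * (1 / 2 * qform Q x) := by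
  have hγ := h1.γ_pos
  have hcσ := h1.cσ_pos
  obtain ⟨C₂, hC₂, τ₂, hτ₂, hstep⟩ := hinv.exists_step hγ hε.le hΛ hlam
  obtain ⟨C₁, hC₁, τ₁, hτ₁, hup⟩ := p.exists_payoff_le hγ (2 * Λ) (by positivity)
  obtain ⟨b, hb⟩ : ∃ b, b = 1 / p.γ ^ 2 * (cσ * Λ) ^ 2 := ⟨_, rfl⟩
  have hb0 : 0 < b := by rw [hb]; positivity
  -- This is `Λ < λ₂` in other terms.
  have hbD : b < mD := by
    rw [lam2, Real.lt_sqrt hΛ.le, lt_div_iff₀ (by positivity)] at hΛ2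
    rw [hb, one_div_mul_eq_div, div_lt_iff₀ (by positivity)]
    linarith
  obtain ⟨η, hη⟩ : ∃ η, η = (mD - b) / 2 := ⟨_, rfl⟩
  have hη0 : 0 < η := by rw [hη]; linarith
  -- Multiples of `|x|²` are converted into multiples of `(1/2) x'Qx`: the gain through `x'Qx ≤
  -- Λ|x|²`, the error through `ε|x|² ≤ x'Qx`. The bound `θ ≤ η / b` yields `(1 + θ)b + η ≤ b + 2η =
  -- mD`, and `θ ≤ 1` keeps `(1 + θ)P` within norm `2Λ`.
  refine ⟨η / Λ, by positivity, 2 * (C₁ + C₂) / ε, by positivity, min 1 (η / b), by positivity,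
    min τ₁ τ₂, lt_min hτ₁ hτ₂, fun τ hτ hτm P hP => ⟨fun m => ?_, ?_⟩⟩
  · obtain ⟨Q, hQ, hQS, -⟩ := hstep τ hτ.le (hτm.trans (min_le_right _ _)) m P hP
    exact ⟨Q, hQ, hQS⟩
  intro θ hθ hθ₁ x w μ ξ hw hμ hξ
  have hθ1 : θ ≤ 1 := hθ₁.trans (min_le_left _ _)
  have hθb : θ * b ≤ η := (le_div_iff₀ hb0).1 (hθ₁.trans (min_le_right _ _))
  have hPs : Pᵀ = P := (mem_Icc_smul_one_iff.1 hP).1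
  have hPn : ‖P‖ ≤ Λ := norm_le_of_mem_Icc hε.le hΛ (loewnerIcc_mono hlam hP)
  have : Nonempty (Fin M) := ⟨⟨0, hM⟩⟩
  obtain ⟨m, hm⟩ := Finite.exists_max fun m => qform (p.Phi m ((1 + θ) • P)) x
  have hub := hup τ hτ (hτm.trans (min_le_left _ _)) ((1 + θ) • P)
    (by rw [Matrix.transpose_smul, hPs]) (by
      rw [norm_smul, Real.norm_of_nonneg (by linarith)]
      exact mul_le_mul (by linarith) hPn (norm_nonneg _) (by norm_num)) x w μ ξ hw hμ hξ _ hm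
  have hPhi := p.qform_Phi_smul_le m hcσ.le (h1.σ_le m) (h2.D_ge m x) hPs hPn hb hθ
    (η := η) (by rw [hη] at hθb ⊢; linarith)
  obtain ⟨Q, hQ, hQS, hlow⟩ := hstep τ hτ.le (hτm.trans (min_le_right _ _)) m P hP
  refine ⟨m, Q, hQ, hQS, ?_⟩
  have hQ' := (mem_Icc_smul_one_iff.1 (loewnerIcc_mono hlam hQ)).2 x
  rw [qform_smul, qform_smul] at hub
  have l1 := mul_le_mul_of_nonneg_left hPhi (by positivity : 0 ≤ τ * (1 / 2))
  have l2 := mul_le_mul_of_nonneg_left (hlow x) (by positivity : 0 ≤ (1 + θ) * (1 / 2))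
  have l3 : θ * (C₂ * τ ^ 2 * ‖x‖ ^ 2) ≤ 1 * (C₂ * τ ^ 2 * ‖x‖ ^ 2) := by gcongr
  have l4 : θ * τ * (η / Λ) * (1 / 2) * qform Q x ≤ θ * τ * (η / Λ) * (1 / 2) * (Λ * ‖x‖ ^ 2) := by
    gcongr
    exact hQ'.2
  have l5 : θ * τ * (η / Λ) * (1 / 2) * (Λ * ‖x‖ ^ 2) = θ * τ * η * (1 / 2) * ‖x‖ ^ 2 := by
    field_simp
  have l6 : (C₁ + C₂) / ε * τ ^ 2 * (ε * ‖x‖ ^ 2) ≤ (C₁ + C₂) / ε * τ ^ 2 * qform Q x := by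
    gcongr
    exact hQ'.1
  have l7 : (C₁ + C₂) / ε * τ ^ 2 * (ε * ‖x‖ ^ 2) = (C₁ + C₂) * τ ^ 2 * ‖x‖ ^ 2 := by
    field_simp
  have l8 : (1 + θ * (1 - η / Λ * τ) + 2 * (C₁ + C₂) / ε * τ ^ 2) * (1 / 2 * qform Q x) =
      (1 + θ) * (1 / 2) * qform Q x - θ * τ * (η / Λ) * (1 / 2) * qform Q x +
        (C₁ + C₂) / ε * τ ^ 2 * qform Q x := by ring
  rw [l8]
  linarith

end OneStep

end SwitchedLQ

/-! ### Propagation of the error through pruning and iteration. -/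

namespace SwitchedLQ

variable {n k M : ℕ}

theorem mem_stepSet {p : SwitchedLQ n k M} {τ : ℝ}
    {F : Finset (EuclideanSpace ℝ (Fin n) → EReal)} {f : EuclideanSpace ℝ (Fin n) → EReal} :
    f ∈ p.stepSet τ F ↔ ∃ m, ∃ g ∈ F, p.Sm m τ g = f := by
  simp [stepSet]

/-- A supremum of finitely many quadratic functions is attained. -/
theorem exists_sup_eq {ε lam : ℝ} {F : Finset (EuclideanSpace ℝ (Fin n) → EReal)}
    (hF : F.Nonempty) (hFP : ∀ f ∈ F, ∃ P ∈ loewnerIcc ε lam, f = quadFun P)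
    (x : EuclideanSpace ℝ (Fin n)) :
    ∃ P ∈ loewnerIcc ε lam, quadFun P ∈ F ∧ F.sup id x = quadFun P x := by
  obtain ⟨f, hf, hfx⟩ := Finset.exists_mem_eq_sup F hF fun f => f x
  obtain ⟨P, hP, rfl⟩ := hFP f hf
  exact ⟨P, hP, hf, by rw [Finset.sup_apply]; exact hfx⟩

theorem le_sup_apply {F : Finset (EuclideanSpace ℝ (Fin n) → EReal)}
    {f : EuclideanSpace ℝ (Fin n) → EReal} (hf : f ∈ F) (x : EuclideanSpace ℝ (Fin n)) :
    f x ≤ F.sup id x :=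
  Finset.le_sup (f := id) hf x

/-- Effect of a pruning of relative error `c` on a set of quadratic functions. -/
theorem prune_step {ε lam c : ℝ} (hε : 0 < ε) (hc : 0 < c)
    {F G : Finset (EuclideanSpace ℝ (Fin n) → EReal)} (hF : F.Nonempty)
    (hFP : ∀ f ∈ F, ∃ P ∈ loewnerIcc ε lam, f = quadFun P)
    (hG : (∀ f ∈ F, ∃ P : Matrix (Fin n) (Fin n) ℝ, P.PosDef ∧ f = quadFun P) →
      G ⊆ F ∧ ∀ x, G.sup id x ≤ F.sup id x ∧ F.sup id x ≤ (c : EReal) * G.sup id x) :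
    G.Nonempty ∧ (∀ f ∈ G, ∃ P ∈ loewnerIcc ε lam, f = quadFun P) ∧
      ∀ Q : Matrix (Fin n) (Fin n) ℝ, quadFun Q ∈ F → ∀ x, ∃ P ∈ loewnerIcc ε lam,
        quadFun P ∈ G ∧ 1 / 2 * qform Q x ≤ c * (1 / 2 * qform P x) := by
  obtain ⟨hGF, hle⟩ := hG fun f hf => by
    obtain ⟨P, hP, rfl⟩ := hFP f hf
    exact ⟨P, posDef_of_mem_Icc hε hP, rfl⟩
  have hGP : ∀ f ∈ G, ∃ P ∈ loewnerIcc ε lam, f = quadFun P := fun f hf => hFP f (hGF hf)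
  -- An empty selection would have supremum `⊥`, and `c * ⊥ = ⊥` cannot bound a real value.
  have hGn : G.Nonempty := by
    by_contra hne
    rw [Finset.not_nonempty_iff_eq_empty] at hne
    have h := (hle 0).2
    obtain ⟨P, -, -, hP⟩ := exists_sup_eq hF hFP 0
    rw [hne, hP, Finset.sup_empty, Pi.bot_apply, EReal.coe_mul_bot_of_pos hc, le_bot_iff] at h
    exact EReal.coe_ne_bot _ h
  refine ⟨hGn, hGP, fun Q hQ x => ?_⟩
  obtain ⟨P, hP, hPG, hPx⟩ := exists_sup_eq hGn hGP x
  refine ⟨P, hP, hPG, ?_⟩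
  have h := (le_sup_apply hQ x).trans (hle x).2
  rw [hPx, quadFun, quadFun, ← EReal.coe_mul, EReal.coe_le_coe_iff] at h
  exact h

/-- Error propagation: if a step of size `τ` followed by pruning with relative error `c` maps the
relative error `θ` to itself, then `θ` bounds the error after any number of steps. -/
theorem payoff_le_prunedSet {p : SwitchedLQ n k M} {ε lam τ α C θ c : ℝ} (hε : 0 < ε)
    (hτ : 0 < τ) (hθ : 0 ≤ θ) (hc : 0 < c) (hρ : 0 ≤ 1 + θ * (1 - α * τ) + C * τ ^ 2)
    (hρc : (1 + θ * (1 - α * τ) + C * τ ^ 2) * c ≤ 1 + θ)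
    (hone : ∀ P ∈ loewnerIcc ε lam,
        (∀ m, ∃ Q ∈ loewnerIcc ε lam, p.Sm m τ (quadFun P) = quadFun Q) ∧
        ∀ x w μ ξ, IsDisturbance w → Measurable μ →
          p.IsTrajectory τ x w μ ξ → ∃ m, ∃ Q ∈ loewnerIcc ε lam,
            p.Sm m τ (quadFun P) = quadFun Q ∧
            p.cost τ w μ ξ + (1 + θ) * (1 / 2 * qform P (ξ τ)) ≤
              (1 + θ * (1 - α * τ) + C * τ ^ 2) * (1 / 2 * qform Q x)) (m₀ : Fin M)
    {prune : Finset (EuclideanSpace ℝ (Fin n) → EReal) →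
      Finset (EuclideanSpace ℝ (Fin n) → EReal)}
    (hprune : ∀ F : Finset (EuclideanSpace ℝ (Fin n) → EReal), F.Nonempty →
      (∀ f ∈ F, ∃ P : Matrix (Fin n) (Fin n) ℝ, P.PosDef ∧ f = quadFun P) →
      prune F ⊆ F ∧ ∀ x, (prune F).sup id x ≤ F.sup id x ∧
        F.sup id x ≤ (c : EReal) * (prune F).sup id x)
    {P₀ : Matrix (Fin n) (Fin n) ℝ} (hP₀ : P₀ ∈ loewnerIcc ε lam) (N : ℕ) :
    (p.prunedSet τ prune (quadFun P₀) N).Nonempty ∧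
      (∀ f ∈ p.prunedSet τ prune (quadFun P₀) N, ∃ P ∈ loewnerIcc ε lam, f = quadFun P) ∧
      ∀ x w μ ξ, IsDisturbance w → Measurable μ → p.IsTrajectory (N * τ) x w μ ξ →
        ∃ P ∈ loewnerIcc ε lam, quadFun P ∈ p.prunedSet τ prune (quadFun P₀) N ∧
          p.cost (N * τ) w μ ξ + 1 / 2 * qform P₀ (ξ (N * τ)) ≤
            (1 + θ) * (1 / 2 * qform P x) := by
  induction N with
  | zero =>
    refine ⟨Finset.singleton_nonempty _, fun f hf => ⟨P₀, hP₀, Finset.mem_singleton.1 hf⟩, ?_⟩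
    intro x w μ ξ _ _ hξ
    refine ⟨P₀, hP₀, Finset.mem_singleton_self _, ?_⟩
    have h0 : ((0 : ℕ) : ℝ) * τ = 0 := by simp
    rw [h0] at hξ ⊢
    have hx : ξ 0 = x := by simpa using hξ.2 0 ⟨le_rfl, le_rfl⟩
    have hq : 0 ≤ qform P₀ x :=
      (by positivity : 0 ≤ ε * ‖x‖ ^ 2).trans ((mem_Icc_smul_one_iff.1 hP₀).2 x).1
    rw [hx, cost, intervalIntegral.integral_same]
    nlinarith [mul_nonneg hθ hq]
  | succ N ih =>
    obtain ⟨hne, hquad, hpay⟩ := ih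
    set F := p.prunedSet τ prune (quadFun P₀) N with hF
    have hSne : (p.stepSet τ F).Nonempty := by
      obtain ⟨f, hf⟩ := hne
      exact ⟨_, mem_stepSet.2 ⟨m₀, f, hf, rfl⟩⟩
    have hSquad : ∀ f ∈ p.stepSet τ F, ∃ P ∈ loewnerIcc ε lam, f = quadFun P := by
      intro f hf
      obtain ⟨m, g, hg, rfl⟩ := mem_stepSet.1 hf
      obtain ⟨P, hP, rfl⟩ := hquad g hg
      exact (hone P hP).1 m
    obtain ⟨g1, g2, g3⟩ := prune_step hε hc hSne hSquad (hprune _ hSne)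
    refine ⟨g1, g2, ?_⟩
    intro x w μ ξ hw hμ hξ
    -- The last operator applied acts on the first interval of the trajectory. The induction
    -- hypothesis handles the tail from `ξ τ`, and the `P` it yields may depend on that tail.
    have hN : ((N + 1 : ℕ) : ℝ) * τ = τ + N * τ := by push_cast; ring
    have hNτ : 0 ≤ (N : ℝ) * τ := by positivity
    rw [hN] at hξ ⊢
    obtain ⟨P, hP, hPF, hle⟩ := hpay (ξ τ) _ (fun t => μ (t + τ)) _ (hw.shift hτ.le)
      (hμ.comp (measurable_id.add_const τ)) (hξ.shift hτ.le hw hμ)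
    obtain ⟨m, Q, hQ, hQS, hle2⟩ := (hone P hP).2 x w μ ξ hw hμ
      (hξ.mono (le_add_of_nonneg_right hNτ))
    obtain ⟨P', hP', hP'F, hle3⟩ := g3 Q (mem_stepSet.2 ⟨m, _, hPF, hQS⟩) x
    refine ⟨P', hP', hP'F, ?_⟩
    have hq : 0 ≤ qform P' x :=
      (by positivity : 0 ≤ ε * ‖x‖ ^ 2).trans ((mem_Icc_smul_one_iff.1 hP').2 x).1
    rw [p.cost_add hτ.le hNτ hw hμ hξ.1, add_comm τ]
    have s1 := mul_le_mul_of_nonneg_left hle3 hρ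
    have s2 := mul_le_mul_of_nonneg_right hρc (by positivity : 0 ≤ 1 / 2 * qform P' x)
    linarith

/-- The step size may be chosen so small that the error `K τ^s` is stable and small. -/
theorem exists_stable_error {α C L r θ₁ : ℝ} (hα : 0 < α) (hC : 0 < C) (hL : 0 < L) (hr : 1 < r)
    (hθ₁ : 0 < θ₁) : ∃ K : ℝ, 0 < K ∧ ∃ τ₀ : ℝ, 0 < τ₀ ∧ ∀ τ : ℝ, 0 < τ → τ ≤ τ₀ →
      K * τ ^ min 1 (r - 1) ≤ θ₁ ∧
      0 ≤ 1 + K * τ ^ min 1 (r - 1) * (1 - α * τ) + C * τ ^ 2 ∧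
      (1 + K * τ ^ min 1 (r - 1) * (1 - α * τ) + C * τ ^ 2) * (1 + L * τ ^ r) ≤
        1 + K * τ ^ min 1 (r - 1) := by
  set s := min 1 (r - 1) with hs
  have hs0 : 0 < s := lt_min one_pos (by linarith)
  -- With this `K` the gain `Θ α τ` equals the loss bound `(C + L(2 + C)) τ ^ (1 + s)`. The factor
  -- `2 + C` bounds the pre-pruning factor, since `Θ ≤ 1` and `τ ≤ 1`.
  set K := (C + L * (2 + C)) / α with hK
  have hK0 : 0 < K := by positivity
  set δ := min θ₁ 1 with hδ
  have hδ0 : 0 < δ := lt_min hθ₁ one_pos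
  refine ⟨K, hK0, min (min 1 (1 / α)) ((δ / K) ^ s⁻¹), by positivity, fun τ hτ hle => ?_⟩
  have hτ1 : τ ≤ 1 := hle.trans ((min_le_left _ _).trans (min_le_left _ _))
  have hτα : α * τ ≤ 1 := by
    have := hle.trans ((min_le_left _ _).trans (min_le_right _ _))
    rw [le_div_iff₀ hα] at this
    linarith
  have hΘδ : K * τ ^ s ≤ δ := by
    have h1 := Real.rpow_le_rpow hτ.le (hle.trans (min_le_right _ _)) hs0.le
    rw [Real.rpow_inv_rpow (by positivity) hs0.ne', le_div_iff₀ hK0] at h1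
    linarith
  set Θ := K * τ ^ s with hΘ
  have hΘ0 : 0 ≤ Θ := by positivity
  have hΘ1 : Θ ≤ 1 := hΘδ.trans (min_le_right _ _)
  have h1 : 0 ≤ Θ * (1 - α * τ) := mul_nonneg hΘ0 (by linarith)
  have h2 : Θ * (1 - α * τ) ≤ 1 := by
    have : 0 ≤ Θ * (α * τ) := by positivity
    linarith
  have h3 : C * τ ^ 2 ≤ C := by
    have : τ ^ 2 ≤ 1 := pow_le_one₀ hτ.le hτ1
    nlinarith
  refine ⟨hΘδ.trans (min_le_left _ _), by positivity, ?_⟩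
  -- Both `1 + s ≤ 2` and `1 + s ≤ r` are needed, which dictates the exponent `s = min 1 (r - 1)`.
  have e1 : τ ^ (2 : ℕ) ≤ τ ^ (1 + s) := by
    rw [← Real.rpow_natCast]
    refine Real.rpow_le_rpow_of_exponent_ge hτ hτ1 ?_
    have : s ≤ 1 := min_le_left _ _
    push_cast; linarith
  have e2 : τ ^ r ≤ τ ^ (1 + s) := by
    refine Real.rpow_le_rpow_of_exponent_ge hτ hτ1 ?_
    have : s ≤ r - 1 := min_le_right _ _
    linarith
  have e3 : Θ * (α * τ) = (C + L * (2 + C)) * τ ^ (1 + s) := by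
    rw [hΘ, hK, Real.rpow_add hτ, Real.rpow_one]
    field_simp
  have e4 : (1 + Θ * (1 - α * τ) + C * τ ^ 2) * (L * τ ^ r) ≤ (2 + C) * (L * τ ^ (1 + s)) := by
    gcongr
    linarith
  have e5 : C * τ ^ 2 ≤ C * τ ^ (1 + s) := by gcongr
  linarith

/-- The stable relative error becomes an absolute one through `x'Px ≤ Λ|x|²`. -/
theorem exists_error_bound (hM : 0 < M) (p : SwitchedLQ n k M) {cA cσ cD mD : ℝ}
    (h1 : p.Assumption1 cA cσ cD) (h2 : p.Assumption2 cA cσ cD mD)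
    {lam : ℝ} (hlam : lam < p.lam2 cσ mD)
    {ε : ℝ} (hε : 0 < ε) (hinv : p.IsInvariantInterval ε lam) {r : ℝ} (hr : 1 < r)
    {prune : ℝ → Finset (EuclideanSpace ℝ (Fin n) → EReal) →
          Finset (EuclideanSpace ℝ (Fin n) → EReal)} (hprune : IsPruningOfOrder prune r) :
    ∃ τ₀ : ℝ, 0 < τ₀ ∧ ∃ L : ℝ, 0 < L ∧
      ∀ (N : ℕ) (τ : ℝ), 0 < τ → τ ≤ τ₀ →
      ∀ P₀ ∈ loewnerIcc ε lam, ∀ x : EuclideanSpace ℝ (Fin n),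
        ∃ a b : ℝ, p.S (N * τ) (quadFun P₀) x = (a : EReal) ∧
          p.prunedIterate τ (prune τ) N (quadFun P₀) x = (b : EReal) ∧
          a - b ≤ L * τ ^ min 1 (r - 1) * ‖x‖ ^ 2 := by
  have hl2 := h2.lam2_pos h1
  -- The maximum provides an upper bound for `lam` that is positive and still below `λ₂`.
  obtain ⟨Λ, hΛ⟩ : ∃ Λ, Λ = max lam (p.lam2 cσ mD / 2) := ⟨_, rfl⟩
  have hΛ0 : 0 < Λ := by rw [hΛ]; exact lt_max_of_lt_right (by positivity)
  have hΛ2 : Λ < p.lam2 cσ mD := by rw [hΛ]; exact max_lt hlam (by linarith)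
  have hlΛ : lam ≤ Λ := by rw [hΛ]; exact le_max_left _ _
  obtain ⟨α, hα, C, hC, θ₁, hθ₁, τ₁, hτ₁, hone⟩ :=
    p.exists_one_step hM h1 h2 hε hΛ0 hΛ2 hlΛ hinv
  obtain ⟨L, hL, hprune⟩ := hprune
  obtain ⟨K, hK, τ₀, hτ₀, hstable⟩ := exists_stable_error hα hC hL hr hθ₁
  refine ⟨min τ₀ τ₁, lt_min hτ₀ hτ₁, K * (1 / 2 * Λ), by positivity, ?_⟩
  intro N τ hτ hτm P₀ hP₀ x
  obtain ⟨hΘ, hρ, hρc⟩ := hstable τ hτ (hτm.trans (min_le_left _ _))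
  set Θ := K * τ ^ min 1 (r - 1) with hΘd
  have hΘ0 : 0 ≤ Θ := by positivity
  obtain ⟨hne, hquad, hpay⟩ := payoff_le_prunedSet (p := p) hε hτ hΘ0 (by positivity) hρ hρc
    (fun P hP => ⟨(hone τ hτ (hτm.trans (min_le_right _ _)) P hP).1,
      (hone τ hτ (hτm.trans (min_le_right _ _)) P hP).2 Θ hΘ0 hΘ⟩) ⟨0, hM⟩ (hprune τ hτ) hP₀ N
  obtain ⟨P, hP, -, hPx⟩ := exists_sup_eq hne hquad x
  have hle : p.S (N * τ) (quadFun P₀) x ≤ (((1 + Θ) * (1 / 2 * qform P x) : ℝ) : EReal) := by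
    refine sSup_le ?_
    rintro v ⟨w, μ, ξ, hw, hμ, hξ, rfl⟩
    obtain ⟨Q, hQ, hQF, hQle⟩ := hpay x w μ ξ hw hμ hξ
    have h3 := le_sup_apply hQF x
    rw [hPx, quadFun, quadFun, EReal.coe_le_coe_iff] at h3
    rw [payoff_quadFun, EReal.coe_le_coe_iff]
    exact hQle.trans (mul_le_mul_of_nonneg_left h3 (by linarith))
  -- A supremum over no trajectories would be `⊥`; one trajectory is enough to exclude this.
  have hbot : p.S (N * τ) (quadFun P₀) x ≠ ⊥ := by
    obtain ⟨w, ξ, hw, hξ⟩ := p.exists_trajectory ⟨0, hM⟩ (N * τ) x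
    have hv : p.payoff (N * τ) (quadFun P₀) w (fun _ => ⟨0, hM⟩) ξ ≤
        p.S (N * τ) (quadFun P₀) x := le_sSup ⟨w, _, ξ, hw, measurable_const, hξ, rfl⟩
    refine ne_bot_of_le_ne_bot ?_ hv
    rw [payoff_quadFun]
    exact EReal.coe_ne_bot _
  have htop : p.S (N * τ) (quadFun P₀) x ≠ ⊤ := ne_top_of_le_ne_top (EReal.coe_ne_top _) hle
  refine ⟨(p.S (N * τ) (quadFun P₀) x).toReal, 1 / 2 * qform P x,
    (EReal.coe_toReal htop hbot).symm, hPx, ?_⟩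
  have hle' : (p.S (N * τ) (quadFun P₀) x).toReal ≤ (1 + Θ) * (1 / 2 * qform P x) := by
    rw [← EReal.coe_le_coe_iff, EReal.coe_toReal htop hbot]
    exact hle
  have hPΛ := ((mem_Icc_smul_one_iff.1 (loewnerIcc_mono hlΛ hP)).2 x).2
  have := mul_le_mul_of_nonneg_left hPΛ (by positivity : 0 ≤ Θ * (1 / 2))
  have e : K * (1 / 2 * Λ) * τ ^ min 1 (r - 1) * ‖x‖ ^ 2 = Θ * (1 / 2) * (Λ * ‖x‖ ^ 2) := by
    rw [hΘd]; ring
  rw [e]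
  linarith

end SwitchedLQ

/-! ### The unpruned case as trivial pruning, and the conclusion. -/

theorem isPruningOfOrder_id {n : ℕ} (r : ℝ) :
    IsPruningOfOrder (n := n) (fun _ F => F) r := by
  refine ⟨1, one_pos, fun τ hτ F hF hquad => ⟨Finset.Subset.refl _, fun x => ⟨le_rfl, ?_⟩⟩⟩
  obtain ⟨f, hf, hfx⟩ := Finset.exists_mem_eq_sup F hF fun f => f x
  obtain ⟨P, hP, rfl⟩ := hquad f hf
  have hx : F.sup id x = quadFun P x := by rw [Finset.sup_apply]; exact hfx
  -- A factor at least 1 can only increase a nonnegative value, so keeping everything is a pruning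
  -- of any order.
  have hq : 0 ≤ qform P x := by
    have := hP.posSemidef.dotProduct_mulVec_nonneg x.ofLp
    simpa [qform] using this
  rw [hx, quadFun, ← EReal.coe_mul, EReal.coe_le_coe_iff]
  have : 0 ≤ 1 * τ ^ r * (1 / 2 * qform P x) := by positivity
  linarith

theorem SwitchedLQ.prunedIterate_id {n k M : ℕ} (p : SwitchedLQ n k M) (τ : ℝ) (N : ℕ)
    (V : EuclideanSpace ℝ (Fin n) → EReal) :
    p.prunedIterate τ (fun F => F) N V = (p.tildeS τ)^[N] V := by
  induction N with
  | zero => simp [prunedIterate, prunedSet]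
  | succ N ih =>
    rw [Function.iterate_succ_apply', ← ih]
    exact p.sup_stepSet τ _

theorem mainTheorem2 {n k M : ℕ} (hM : 0 < M) (p : SwitchedLQ n k M) (cA cσ cD mD : ℝ)
    (h1 : p.Assumption1 cA cσ cD) (h2 : p.Assumption2 cA cσ cD mD)
    (lam : ℝ) (hlam : lam ∈ Set.Ico (p.lam1 cA cσ cD) (p.lam2 cσ mD))
    (ε : ℝ) (hε : 0 < ε) (hinv : p.IsInvariantInterval ε lam) :
    (∀ r : ℝ, 1 < r →
      ∀ prune : ℝ → Finset (EuclideanSpace ℝ (Fin n) → EReal) →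
          Finset (EuclideanSpace ℝ (Fin n) → EReal),
        IsPruningOfOrder prune r →
        ∃ τ₀ : ℝ, 0 < τ₀ ∧ ∃ L : ℝ, 0 < L ∧
          ∀ (N : ℕ) (τ : ℝ), 0 < τ → τ ≤ τ₀ →
          ∀ P₀ ∈ Set.Icc (ε • (1 : Matrix (Fin n) (Fin n) ℝ))
            (lam • (1 : Matrix (Fin n) (Fin n) ℝ)),
          ∀ x : EuclideanSpace ℝ (Fin n),
            ∃ a b : ℝ, p.S (N * τ) (quadFun P₀) x = (a : EReal) ∧
              p.prunedIterate τ (prune τ) N (quadFun P₀) x = (b : EReal) ∧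
              a - b ≤ L * τ ^ min 1 (r - 1) * ‖x‖ ^ 2) ∧
    (∃ τ₀ : ℝ, 0 < τ₀ ∧ ∃ L : ℝ, 0 < L ∧
      ∀ (N : ℕ) (τ : ℝ), 0 < τ → τ ≤ τ₀ →
      ∀ P₀ ∈ Set.Icc (ε • (1 : Matrix (Fin n) (Fin n) ℝ))
        (lam • (1 : Matrix (Fin n) (Fin n) ℝ)),
      ∀ x : EuclideanSpace ℝ (Fin n),
        ∃ a b : ℝ, p.S (N * τ) (quadFun P₀) x = (a : EReal) ∧
          (p.tildeS τ)^[N] (quadFun P₀) x = (b : EReal) ∧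
          a - b ≤ L * τ * ‖x‖ ^ 2) := by
  refine ⟨fun r hr prune hprune =>
    p.exists_error_bound hM h1 h2 hlam.2 hε hinv hr hprune, ?_⟩
  -- The order `r = 2` suffices, as it already gives `min 1 (r - 1) = 1`.
  obtain ⟨τ₀, hτ₀, L, hL, h⟩ :=
    p.exists_error_bound hM h1 h2 hlam.2 hε hinv one_lt_two (isPruningOfOrder_id 2)
  refine ⟨τ₀, hτ₀, L, hL, fun N τ hτ hτ' P₀ hP₀ x => ?_⟩
  obtain ⟨a, b, ha, hb, hab⟩ := h N τ hτ hτ' P₀ hP₀ x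
  rw [p.prunedIterate_id] at hb
  have he : min (1 : ℝ) (2 - 1) = 1 := by norm_num
  rw [he, Real.rpow_one] at hab
  exact ⟨a, b, ha, hb, hab⟩
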